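/- An \emph{effect algebra} is a set $E$ with a partial binary operation $\oplus$, a unary operation $'$ and constants $0,1$ such that $\oplus$ is commutative and associative (as Kleene identities), $a\oplus b=1$ iff $b=a'$, and $a\oplus 1$ is defined iff $a=0$, with $0\oplus 1=1$; $a\le b$ means $a\oplus c=b$ for some $c$. A \emph{GEA-homomorphism} is a map preserving existing orthosums; a homomorphism of effect algebras moreover preserves $1$. This gives the category $\mathbf{EA}$. Let $\mathbf{POG}_u$ be the category of partially ordered Abelian groups $(A,u)$ with an order unit $u\ge 0$ (every $x\in A$ satisfies $x\le nu$ for some $n\in\mathbb N$) and positive group homomorphisms preserving the order units. $\Gamma(A,u)$ is the effect algebra on $[0,u]\subseteq A$ in which $a\oplus b=c$ means $a+b=c$; $\mathrm{Gr}\colon\mathbf{EA}\to\mathbf{POG}_u$ is the universal group functor (left adjoint of $\Gamma$), with unit $\eta_E\colon E\to\Gamma(\mathrm{Gr}(E),[1])$, $x\mapsto[x]$. Tensor products in $\mathbf{EA}$ and in $\mathbf{POG}_u$ are the objects universal for bihomomorphisms; in $\mathbf{POG}_u$ this is $A\otimes_{\mathbb Z}B$ with the cone of sums of tensors of positive elements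 and the order unit $u\otimes v$. For an effect algebra homomorphism $h\colon E\to G$ let $[E,G]_h$ be the effect algebra of all GEA-homomorphisms $g\colon E\to G$ with $g\le h$ pointwise, with pointwise operation and greatest element $h$. For a morphism $h\colon(A,u)\to(B,v)$ of $\mathbf{POG}_u$ let $[A,B]_h$ be the group of those group homomorphisms $f\colon A\to B$ such that $-nh\le f\le nh$ for some $n\in\mathbb N$, where $f\le g$ means that $g-f$ is positive, with order unit $h$. For a category $\mathcal C$ and an object $X$, $X\downarrow\mathcal C$ is the category of arrows out of $X$. The assignments $h\mapsto[E,G]_h$ and $h\mapsto[A,B]_h$ are functors $E\downarrow\mathbf{EA}\to\mathbf{EA}$ and $A\downarrow\mathbf{POG}_u\to\mathbf{POG}_u$; on the other side, $E\otimes-\colon\mathbf{EA}\to E\downarrow\mathbf{EA}$ sends $F$ to $x\mapsto x\otimes1$, and $A\otimes-\colon\mathbf{POG}_u\to A\downarrow\mathbf{POG}_u$ sends $(B,v)$ to $a\mapsto a\otimes v$. Finally, $\mathrm{Gr}$ induces $\mathrm{Gr}\colon E\downarrow\mathbf{EA}\to\mathrm{Gr}(E)\downarrow\mathbf{POG}_u$,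 and $\Gamma\colon\mathrm{Gr}(E)\downarrow\mathbf{POG}_u\to E\downarrow\mathbf{EA}$ sends $h\colon\mathrm{Gr}(E)\to(B,v)$ to $\bar h=\Gamma(h)\circ\eta_E$. \textbf{Theorem.} Let $E$ be an effect algebra. (1) For every effect algebra $F$ there is an isomorphism $\mathrm{Gr}(E\otimes F)\cong\mathrm{Gr}(E)\otimes\mathrm{Gr}(F)$ in $\mathbf{POG}_u$. These isomorphisms can be chosen to form a natural isomorphism $\alpha$, natural in $F$, of functors $\mathbf{EA}\to\mathrm{Gr}(E)\downarrow\mathbf{POG}_u$ from $F\mapsto\bigl(\mathrm{Gr}(E)\to\mathrm{Gr}(E\otimes F)\bigr)$ to $F\mapsto\bigl(\mathrm{Gr}(E)\to\mathrm{Gr}(E)\otimes\mathrm{Gr}(F)\bigr)$. (2) There is an isomorphism of effect algebras $$\beta_h\colon\ \Gamma([\mathrm{Gr}(E),B]_h,h)\ \cong\ [E,\Gamma(B,v)]_{\bar h},\qquad \beta_h(g)(x)=g([x]),$$ natural in the object $h\colon\mathrm{Gr}(E)\to(B,v)$ of $\mathrm{Gr}(E)\downarrow\mathbf{POG}_u$.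 (3) There are adjunctions $\mathrm{Gr}\dashv\Gamma$ (between $\mathbf{EA}$ and $\mathbf{POG}_u$, with unit $\eta$), $\mathrm{Gr}\dashv\Gamma$ (between $E\downarrow\mathbf{EA}$ and $\mathrm{Gr}(E)\downarrow\mathbf{POG}_u$, with unit given by $\eta$), $E\otimes-\dashv[E,-]_-$ (with unit $y\mapsto(x\mapsto x\otimes y)$) and $\mathrm{Gr}(E)\otimes-\dashv[\mathrm{Gr}(E),-]_-$ (with unit $b\mapsto(a\mapsto a\otimes b)$), and $\alpha$ in (1) and $\beta$ in (2) can be chosen conjugate to each other with respect to the two composite adjunctions of this square. -/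

import Mathlib

open CategoryTheory TensorProduct

universe u

/-! ## Effect algebras -/

/-- An effect algebra. The partial operation `⊕` is `Option`-valued: `oplus a b = none` means that
`a ⊕ b` is undefined. The law `oplus_assoc` is a Kleene identity. -/
structure EA : Type (u + 1) where
  carrier : Type u
  oplus : carrier → carrier → Option carrier
  compl : carrier → carrier
  zero : carrier
  one : carrier
  oplus_comm : ∀ a b, oplus a b = oplus b a
  oplus_assoc : ∀ a b c,
    ((oplus a b).bind fun x => oplus x c) = (oplus b c).bind fun y => oplus a y
  oplus_eq_one : ∀ a b, oplus a b = some one ↔ b = compl a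
  oplus_one_defined : ∀ a, (∃ c, oplus a one = some c) ↔ a = zero
  zero_oplus_one : oplus zero one = some one

namespace EA

instance : CoeSort EA.{u} (Type u) := ⟨EA.carrier⟩

/-- The algebraic order of an effect algebra. -/
def le (E : EA.{u}) (a b : E) : Prop := ∃ c, E.oplus a c = some b

theorem assoc_right (E : EA.{u}) {a b c x y : E} (h1 : E.oplus a b = some x)
    (h2 : E.oplus x c = some y) : ∃ z, E.oplus b c = some z ∧ E.oplus a z = some y := by
  have := E.oplus_assoc a b c
  rw [h1, Option.bind_some, h2] at this
  exact Option.bind_eq_some_iff.1 this.symm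

theorem assoc_left (E : EA.{u}) {a b c y z : E} (h1 : E.oplus b c = some z)
    (h2 : E.oplus a z = some y) : ∃ x, E.oplus a b = some x ∧ E.oplus x c = some y := by
  have := E.oplus_assoc a b c
  rw [h1, Option.bind_some, h2] at this
  exact Option.bind_eq_some_iff.1 this

theorem oplus_compl (E : EA.{u}) (a : E) : E.oplus a (E.compl a) = some E.one :=
  (E.oplus_eq_one a _).2 rfl

theorem cancel (E : EA.{u}) {a b c d : E} (h1 : E.oplus a b = some d)
    (h2 : E.oplus a c = some d) : b = c := by
  have key : ∀ b, E.oplus a b = some d → ∃ z, E.oplus a (E.compl d) = some z ∧ b = E.compl z := by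
    intro b h
    rw [E.oplus_comm] at h
    obtain ⟨z, hz, hbz⟩ := E.assoc_right h (E.oplus_compl d)
    exact ⟨z, hz, (E.oplus_eq_one _ _).1 ((E.oplus_comm _ _).trans hbz)⟩
  obtain ⟨z, hz, rfl⟩ := key b h1
  obtain ⟨w, hw, rfl⟩ := key c h2
  rw [hz] at hw
  rw [Option.some.inj hw]

theorem oplus_zero (E : EA.{u}) (a : E) : E.oplus a E.zero = some a := by
  have h := E.oplus_compl a
  rw [E.oplus_comm] at h
  have h0 : E.oplus E.one E.zero = some E.one := (E.oplus_comm _ _).trans E.zero_oplus_one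
  obtain ⟨z, hz, hz'⟩ := E.assoc_right h h0
  rw [hz, E.cancel hz' h]

theorem zero_oplus (E : EA.{u}) (a : E) : E.oplus E.zero a = some a :=
  (E.oplus_comm _ _).trans (E.oplus_zero a)

theorem eq_zero_of_oplus_eq_self (E : EA.{u}) {a b : E} (h : E.oplus a b = some a) : b = E.zero :=
  E.cancel h (E.oplus_zero a)

theorem eq_zero_of_oplus_eq_zero (E : EA.{u}) {a b : E} (h : E.oplus a b = some E.zero) :
    a = E.zero := by
  obtain ⟨z, hz, -⟩ := E.assoc_right ((E.oplus_comm _ _).trans h) E.zero_oplus_one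
  exact (E.oplus_one_defined a).1 ⟨z, hz⟩

/-- The graph `S a b c` (read `a ⊕ b = c`) of the operation of an effect algebra. -/
structure Graph (X : Type u) : Type u where
  S : X → X → X → Prop
  zero : X
  one : X
  func : ∀ {a b c d}, S a b c → S a b d → c = d
  comm : ∀ {a b c}, S a b c → S b a c
  assoc : ∀ {a b c x y}, S a b x → S x c y → ∃ w, S b c w ∧ S a w y
  compl : ∀ a, ∃! b, S a b one
  one_right : ∀ {a c}, S a one c → a = zero
  zero_one : S zero one one

open Classical in
/-- The partial operation with a given graph. -/
noncomputable def Graph.op {X : Type u} (d : Graph X) (a b : X) : Option X :=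
  if h : ∃ c, d.S a b c then some h.choose else none

theorem Graph.op_eq_some {X : Type u} (d : Graph X) (a b c : X) :
    d.op a b = some c ↔ d.S a b c := by
  unfold Graph.op
  by_cases h : ∃ c, d.S a b c
  · rw [dif_pos h, Option.some_inj]
    exact ⟨fun e => e ▸ h.choose_spec, fun hc => d.func h.choose_spec hc⟩
  · rw [dif_neg h]
    simpa using fun hc => h ⟨c, hc⟩

/-- The effect algebra whose partial operation has the given graph. -/
noncomputable def ofGraph {X : Type u} (d : Graph X) : EA.{u} where
  carrier := X
  oplus := d.op
  compl a := (d.compl a).choose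
  zero := d.zero
  one := d.one
  oplus_comm a b := by
    ext c
    rw [d.op_eq_some, d.op_eq_some]
    exact ⟨d.comm, d.comm⟩
  oplus_assoc a b c := by
    ext y
    simp only [Option.bind_eq_some_iff, d.op_eq_some]
    constructor
    · rintro ⟨x, h1, h2⟩
      exact d.assoc h1 h2
    · rintro ⟨w, h1, h2⟩
      obtain ⟨v, h3, h4⟩ := d.assoc (d.comm h1) (d.comm h2)
      exact ⟨v, d.comm h3, d.comm h4⟩
  oplus_eq_one a b := by
    rw [d.op_eq_some]
    exact ⟨fun h => (d.compl a).choose_spec.2 b h, fun h => h ▸ (d.compl a).choose_spec.1⟩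
  oplus_one_defined a := by
    simp only [d.op_eq_some]
    exact ⟨fun ⟨c, h⟩ => d.one_right h, fun h => ⟨d.one, h ▸ d.zero_one⟩⟩
  zero_oplus_one := (d.op_eq_some _ _ _).2 d.zero_one

/-- A homomorphism of generalized effect algebras between effect algebras: a map that preserves
existing orthosums. -/
@[ext]
structure GHom (E F : EA.{u}) : Type u where
  toFun : E → F
  map_oplus : ∀ a b c, E.oplus a b = some c → F.oplus (toFun a) (toFun b) = some (toFun c)

/-- A homomorphism of effect algebras. -/
@[ext]
structure Hom (E F : EA.{u}) : Type u extends GHom E F where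
  map_one : toFun E.one = F.one

instance : Category EA.{u} where
  Hom := Hom
  id E := { toFun := fun a => a, map_oplus := fun _ _ _ h => h, map_one := rfl }
  comp f g :=
    { toFun := fun a => g.toFun (f.toFun a)
      map_oplus := fun a b c h => g.map_oplus _ _ _ (f.map_oplus a b c h)
      map_one := (congrArg g.toFun f.map_one).trans g.map_one }

theorem hom_ext {E F : EA.{u}} {f g : E ⟶ F} (h : ∀ a, f.toFun a = g.toFun a) : f = g :=
  Hom.ext (funext h)

theorem GHom.map_zero {E F : EA.{u}} (f : GHom E F) : f.toFun E.zero = F.zero :=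
  F.eq_zero_of_oplus_eq_self (f.map_oplus _ _ _ (E.oplus_zero E.zero))

/-! ### The interval `[E, G]_h` -/

/-- The underlying set of `[E, G]_h`: the homomorphisms `g : E → G` of generalized effect algebras
with `g ≤ h` pointwise. -/
@[ext]
structure HomLE {E G : EA.{u}} (h : GHom E G) : Type u extends GHom E G where
  le : ∀ a, G.le (toFun a) (h.toFun a)

/-- The pointwise difference `h ⊖ g`. -/
noncomputable def HomLE.diff {E G : EA.{u}} {h : GHom E G} (g : HomLE h) : HomLE h where
  toFun a := (g.le a).choose
  map_oplus a b c habc := by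
    have hg := g.map_oplus a b c habc
    have hh := h.map_oplus a b c habc
    obtain ⟨p, hp, hp'⟩ := G.assoc_right (g.le a).choose_spec hh
    rw [G.oplus_comm] at hp
    obtain ⟨q, hq, hq'⟩ := G.assoc_right (g.le b).choose_spec hp
    obtain ⟨r, hr, hr'⟩ := G.assoc_left hq' hp'
    rw [hg] at hr
    cases hr
    rw [G.oplus_comm, hq, G.cancel hr' (g.le c).choose_spec]
  le a := ⟨g.toFun a, (G.oplus_comm _ _).trans (g.le a).choose_spec⟩

theorem HomLE.oplus_diff {E G : EA.{u}} {h : GHom E G} (g : HomLE h) (a : E) :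
    G.oplus (g.toFun a) (g.diff.toFun a) = some (h.toFun a) := (g.le a).choose_spec

/-- The effect algebra `[E, G]_h`, with the pointwise partial operation: `f ⊕ g = k` if and only if
`f a ⊕ g a = k a` for all `a`. Its greatest element is `h`. -/
noncomputable def homInterval {E G : EA.{u}} (h : GHom E G) : EA.{u} := ofGraph
  { S := fun f g k : HomLE h => ∀ a, G.oplus (f.toFun a) (g.toFun a) = some (k.toFun a)
    zero :=
      { toFun := fun _ => G.zero
        map_oplus := fun _ _ _ _ => G.oplus_zero _
        le := fun _ => ⟨_, G.zero_oplus _⟩ }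
    one := { toGHom := h, le := fun _ => ⟨_, G.oplus_zero _⟩ }
    func := fun h1 h2 =>
      HomLE.ext (funext fun a => Option.some.inj ((h1 a).symm.trans (h2 a)))
    comm := fun h1 a => (G.oplus_comm _ _).trans (h1 a)
    assoc := by
      intro f g k x y h1 h2
      choose w hw hw' using fun a => G.assoc_right (h1 a) (h2 a)
      refine ⟨{ toFun := w, map_oplus := ?_, le := ?_ }, hw, hw'⟩
      · intro a b c habc
        have e1 := f.map_oplus a b c habc
        have e2 := y.map_oplus a b c habc
        obtain ⟨p, hp, hp'⟩ := G.assoc_right (hw' a) e2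
        rw [G.oplus_comm] at hp
        obtain ⟨q, hq, hq'⟩ := G.assoc_right (hw' b) hp
        obtain ⟨r, hr, hr'⟩ := G.assoc_left hq' hp'
        rw [e1] at hr
        cases hr
        rw [G.oplus_comm, hq, G.cancel hr' (hw' c)]
      · intro a
        obtain ⟨t, ht⟩ := y.le a
        have hw'' := hw' a
        rw [G.oplus_comm] at hw''
        obtain ⟨v, hv, hv'⟩ := G.assoc_right hw'' ht
        exact ⟨v, hv'⟩
    compl := fun g => ⟨g.diff, g.oplus_diff, fun k hk =>
      HomLE.ext (funext fun a => G.cancel (hk a) (g.oplus_diff a))⟩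
    one_right := by
      intro f k hk
      refine HomLE.ext (funext fun a => ?_)
      obtain ⟨t, ht⟩ := k.le a
      have e : G.oplus (f.toFun a) (h.toFun a) = some (k.toFun a) := hk a
      rw [G.oplus_comm] at e
      obtain ⟨v, hv, hv'⟩ := G.assoc_right e ht
      rw [G.eq_zero_of_oplus_eq_self hv'] at hv
      exact G.eq_zero_of_oplus_eq_zero hv
    zero_one := fun _ => G.zero_oplus _ }

theorem homInterval_oplus {E G : EA.{u}} {h : GHom E G} (f g k : HomLE h) :
    (homInterval h).oplus f g = some k ↔
      ∀ a, G.oplus (f.toFun a) (g.toFun a) = some (k.toFun a) :=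
  Graph.op_eq_some _ _ _ _

theorem le_map {G G' : EA.{u}} (k : GHom G G') {a b : G} (h : G.le a b) :
    G'.le (k.toFun a) (k.toFun b) := by
  obtain ⟨c, hc⟩ := h
  exact ⟨_, k.map_oplus _ _ _ hc⟩

/-- The functor `[E, -]_-` from `E ↓ EA` to `EA`, sending `h : E → G` to `[E, G]_h` and acting on
morphisms by composition. -/
noncomputable def homFunctor (E : EA.{u}) : Under E ⥤ EA.{u} where
  obj h := homInterval h.hom.toGHom
  map {h h'} k :=
    { toFun := fun f : HomLE h.hom.toGHom =>
        ({ toFun := fun a => k.right.toFun (f.toFun a)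
           map_oplus := fun a b c habc => k.right.map_oplus _ _ _ (f.map_oplus a b c habc)
           le := fun a => by
            rw [← Under.w k]
            exact le_map k.right.toGHom (f.le a) } : HomLE h'.hom.toGHom)
      map_oplus := fun f g e hfg => (homInterval_oplus _ _ _).2 fun a =>
        k.right.map_oplus _ _ _ ((homInterval_oplus _ _ _).1 hfg a)
      map_one := HomLE.ext (funext fun a =>
        congrArg (fun m : E ⟶ h'.right => m.toFun a) (Under.w k)) }
  map_id _ := rfl
  map_comp _ _ := rfl

/-! ### The tensor product of effect algebras -/

/-- A bihomomorphism of effect algebras. -/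
@[ext]
structure Bihom (E F G : EA.{u}) : Type u where
  toFun : E → F → G
  map_oplus_left : ∀ a a' c b, E.oplus a a' = some c →
    G.oplus (toFun a b) (toFun a' b) = some (toFun c b)
  map_oplus_right : ∀ a b b' c, F.oplus b b' = some c →
    G.oplus (toFun a b) (toFun a b') = some (toFun a c)
  map_one_one : toFun E.one F.one = G.one

/-- The orthosum of a finite sequence, if it exists. -/
def osum (G : EA.{u}) : List G → Option G
  | [] => some G.zero
  | a :: l => (osum G l).bind fun s => G.oplus a s

theorem osum_append (G : EA.{u}) (l m : List G) :
    G.osum (l ++ m) = (G.osum l).bind fun x => (G.osum m).bind fun y => G.oplus x y := by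
  induction l with
  | nil => cases h : G.osum m <;> simp [osum, h, zero_oplus]
  | cons a l ih =>
    simp only [List.cons_append, osum, ih]
    cases hl : G.osum l with
    | none => simp
    | some x =>
      cases hm : G.osum m with
      | none => simp
      | some y => simpa using (G.oplus_assoc a x y).symm

theorem osum_append_some (G : EA.{u}) {l m : List G} {z : G} :
    G.osum (l ++ m) = some z ↔
      ∃ x y, G.osum l = some x ∧ G.osum m = some y ∧ G.oplus x y = some z := by
  simp only [osum_append, Option.bind_eq_some_iff]
  constructor
  · rintro ⟨x, hx, y, hy, h⟩
    exact ⟨x, y, hx, hy, h⟩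
  · rintro ⟨x, y, hx, hy, h⟩
    exact ⟨x, hx, y, hy, h⟩

theorem osum_append_comm (G : EA.{u}) (l m : List G) : G.osum (l ++ m) = G.osum (m ++ l) := by
  ext z
  rw [osum_append_some, osum_append_some]
  constructor <;> rintro ⟨x, y, hx, hy, h⟩ <;> exact ⟨y, x, hy, hx, (G.oplus_comm _ _).trans h⟩

theorem osum_singleton (G : EA.{u}) (a : G) : G.osum [a] = some a := by
  simp [osum, oplus_zero]

/-- The orthosum in `G` of the values of a bihomomorphism along a formal sum of simple tensors. -/
def Bihom.eval {E F G : EA.{u}} (β : Bihom E F G) (l : List (E × F)) : Option G :=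
  G.osum (l.map fun p => β.toFun p.1 p.2)

section
variable {E F G : EA.{u}} (β : Bihom E F G)

theorem Bihom.eval_append_some {l m : List (E × F)} {z : G} :
    β.eval (l ++ m) = some z ↔
      ∃ x y, β.eval l = some x ∧ β.eval m = some y ∧ G.oplus x y = some z := by
  rw [eval, List.map_append, osum_append_some]
  rfl

theorem Bihom.eval_append (l m : List (E × F)) :
    β.eval (l ++ m) = (β.eval l).bind fun x => (β.eval m).bind fun y => G.oplus x y := by
  rw [eval, List.map_append, osum_append]
  rfl

theorem Bihom.eval_append_comm (l m : List (E × F)) : β.eval (l ++ m) = β.eval (m ++ l) := by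
  rw [eval, List.map_append, osum_append_comm, ← List.map_append]
  rfl

theorem Bihom.eval_singleton (a : E) (b : F) : β.eval [(a, b)] = some (β.toFun a b) :=
  osum_singleton _ _

theorem Bihom.eval_unit : β.eval [(E.one, F.one)] = some G.one := by
  rw [β.eval_singleton, β.map_one_one]

end

/-- The formal sums of simple tensors that can be completed to a decomposition of the unit (in
every effect algebra in which they can be evaluated). -/
structure TensorPre (E F : EA.{u}) : Type u where
  list : List (E × F)
  good : ∃ m, ∀ (G : EA.{u}) (β : Bihom E F G), β.eval (list ++ m) = some G.one

/-- Two formal sums of simple tensors are identified when all bihomomorphisms identify them. -/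
instance tensorSetoid (E F : EA.{u}) : Setoid (TensorPre E F) where
  r l m := ∀ (G : EA.{u}) (β : Bihom E F G), β.eval l.list = β.eval m.list
  iseqv := ⟨fun _ _ _ => rfl, fun h G β => (h G β).symm, fun h h' G β => (h G β).trans (h' G β)⟩

theorem TensorPre.exists_eval {E F : EA.{u}} (l : TensorPre E F) {G : EA.{u}} (β : Bihom E F G) :
    ∃ x, β.eval l.list = some x := by
  obtain ⟨m, hm⟩ := l.good
  obtain ⟨x, y, hx, -⟩ := β.eval_append_some.1 (hm G β)
  exact ⟨x, hx⟩

/-- The zero, i.e. empty, formal sum. -/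
def TensorPre.zero (E F : EA.{u}) : TensorPre E F where
  list := []
  good := ⟨[(E.one, F.one)], fun _ β => β.eval_unit⟩

/-- The simple tensor `a ⊗ b`. -/
def TensorPre.simple {E F : EA.{u}} (a : E) (b : F) : TensorPre E F where
  list := [(a, b)]
  good := ⟨[(a, F.compl b), (E.compl a, F.one)], fun G β => by
    have h1 := β.map_oplus_right a b _ _ (F.oplus_compl b)
    have h2 := β.map_oplus_left a _ _ F.one (E.oplus_compl a)
    rw [β.map_one_one] at h2
    have : ([(a, b)] ++ [(a, F.compl b), (E.compl a, F.one)] : List (E × F)) =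
      ([(a, b)] ++ [(a, F.compl b)]) ++ [(E.compl a, F.one)] := rfl
    rw [this, β.eval_append_some]
    exact ⟨_, _, β.eval_append_some.2 ⟨_, _, β.eval_singleton _ _, β.eval_singleton _ _, h1⟩,
      β.eval_singleton _ _, h2⟩⟩

/-- The graph of the partial operation of `E ⊗ F`: concatenation of formal sums. -/
def tensorRel {E F : EA.{u}} (x y z : _root_.Quotient (tensorSetoid E F)) : Prop :=
  ∃ l m n : TensorPre E F, n.list = l.list ++ m.list ∧
    _root_.Quotient.mk _ l = x ∧ _root_.Quotient.mk _ m = y ∧ _root_.Quotient.mk _ n = z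

theorem tensorRel_iff {E F : EA.{u}} (l m n : TensorPre E F) :
    tensorRel (_root_.Quotient.mk _ l) (_root_.Quotient.mk _ m) (_root_.Quotient.mk _ n) ↔
      ∀ (G : EA.{u}) (β : Bihom E F G), β.eval (l.list ++ m.list) = β.eval n.list := by
  constructor
  · rintro ⟨l', m', n', h, hl, hm, hn⟩ G β
    rw [← _root_.Quotient.exact hn G β, h, β.eval_append, β.eval_append, _root_.Quotient.exact hl G β,
      _root_.Quotient.exact hm G β]
  · intro h
    obtain ⟨k, hk⟩ := n.good
    refine ⟨l, m, ⟨l.list ++ m.list, k, fun G β => ?_⟩, rfl, rfl, rfl,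
      _root_.Quotient.sound fun G β => h G β⟩
    rw [← hk G β, β.eval_append (l.list ++ m.list), h G β, ← β.eval_append]

/-- The tensor product `E ⊗ F` of effect algebras. Its elements are the formal orthosums of simple
tensors, compared by means of all bihomomorphisms out of `E × F`. See `tensor_universal` for its
universal property. -/
noncomputable def tensor (E F : EA.{u}) : EA.{u} := ofGraph
  { S := tensorRel (E := E) (F := F)
    zero := _root_.Quotient.mk _ (TensorPre.zero E F)
    one := _root_.Quotient.mk _ (TensorPre.simple E.one F.one)
    func := by
      rintro ⟨a⟩ ⟨b⟩ ⟨c⟩ ⟨d⟩ h1 h2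
      exact _root_.Quotient.sound fun G β =>
        ((tensorRel_iff _ _ _).1 h1 G β).symm.trans ((tensorRel_iff _ _ _).1 h2 G β)
    comm := by
      rintro ⟨a⟩ ⟨b⟩ ⟨c⟩ h
      exact (tensorRel_iff _ _ _).2 fun G β =>
        (β.eval_append_comm _ _).trans ((tensorRel_iff _ _ _).1 h G β)
    assoc := by
      rintro ⟨a⟩ ⟨b⟩ ⟨c⟩ ⟨x⟩ ⟨y⟩ h1 h2
      have key : ∀ (G : EA.{u}) (β : Bihom E F G),
          β.eval (a.list ++ (b.list ++ c.list)) = β.eval y.list := by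
        intro G β
        rw [← (tensorRel_iff _ _ _).1 h2 G β, ← List.append_assoc, β.eval_append,
          (tensorRel_iff _ _ _).1 h1 G β, ← β.eval_append]
      obtain ⟨k, hk⟩ := y.good
      refine ⟨_root_.Quotient.mk _ ⟨b.list ++ c.list, a.list ++ k, fun G β => ?_⟩,
        (tensorRel_iff _ _ _).2 fun G β => rfl, (tensorRel_iff _ _ _).2 key⟩
      rw [← hk G β, ← List.append_assoc, β.eval_append, β.eval_append_comm _ a.list, key,
        ← β.eval_append]
    compl := by
      rintro ⟨a⟩
      obtain ⟨k, hk⟩ := a.good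
      refine ⟨_root_.Quotient.mk _ ⟨k, a.list, fun G β => (β.eval_append_comm _ _).trans (hk G β)⟩,
        (tensorRel_iff _ _ _).2 fun G β => (hk G β).trans β.eval_unit.symm, ?_⟩
      rintro ⟨b⟩ hb
      refine _root_.Quotient.sound fun G β => ?_
      have h1 := ((tensorRel_iff _ _ _).1 hb G β).trans β.eval_unit
      obtain ⟨x, y, hx, hy, h⟩ := β.eval_append_some.1 h1
      obtain ⟨x', y', hx', hy', h'⟩ := β.eval_append_some.1 (hk G β)
      rw [hx] at hx'
      cases hx'
      change β.eval b.list = β.eval k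
      rw [hy, hy', G.cancel h h']
    one_right := by
      rintro ⟨a⟩ ⟨c⟩ h
      obtain ⟨k, hk⟩ := c.good
      refine _root_.Quotient.sound fun G β => ?_
      obtain ⟨x, y, hx, -, h'⟩ := β.eval_append_some.1 (hk G β)
      have h1 := ((tensorRel_iff _ _ _).1 h G β).trans hx
      obtain ⟨p, q, hp, hq, h2⟩ := β.eval_append_some.1 h1
      cases (β.eval_unit.symm.trans hq : some G.one = some q)
      rw [(G.oplus_one_defined p).1 ⟨_, h2⟩] at hp
      exact hp
    zero_one := (tensorRel_iff _ _ _).2 fun _ _ => rfl }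

theorem tensor_oplus {E F : EA.{u}} (l m n : TensorPre E F) :
    (tensor E F).oplus (_root_.Quotient.mk _ l) (_root_.Quotient.mk _ m) = some (_root_.Quotient.mk _ n) ↔
      ∀ (G : EA.{u}) (β : Bihom E F G), β.eval (l.list ++ m.list) = β.eval n.list :=
  (Graph.op_eq_some _ _ _ _).trans (tensorRel_iff l m n)

/-- The universal bihomomorphism `E × F → E ⊗ F`. -/
noncomputable def tmul (E F : EA.{u}) : Bihom E F (tensor E F) where
  toFun a b := (_root_.Quotient.mk _ (TensorPre.simple a b) : _root_.Quotient (tensorSetoid E F))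
  map_oplus_left a a' c b h := (tensor_oplus _ _ _).2 fun G β => by
    have : β.eval [(c, b)] = some (β.toFun c b) := β.eval_singleton c b
    exact (β.eval_append_some.2 ⟨_, _, β.eval_singleton _ _, β.eval_singleton _ _,
      β.map_oplus_left a a' c b h⟩).trans this.symm
  map_oplus_right a b b' c h := (tensor_oplus _ _ _).2 fun G β => by
    have : β.eval [(a, c)] = some (β.toFun a c) := β.eval_singleton a c
    exact (β.eval_append_some.2 ⟨_, _, β.eval_singleton _ _, β.eval_singleton _ _,
      β.map_oplus_right a b b' c h⟩).trans this.symm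
  map_one_one := rfl

/-- The homomorphism `E ⊗ F → G` induced by a bihomomorphism. -/
noncomputable def tensorLift {E F G : EA.{u}} (β : Bihom E F G) : tensor E F ⟶ G :=
  have spec : ∀ l : TensorPre E F, β.eval l.list = some (l.exists_eval β).choose :=
    fun l => (l.exists_eval β).choose_spec
  { toFun := _root_.Quotient.lift (s := tensorSetoid E F) (fun l => (l.exists_eval β).choose)
      fun l m h => Option.some.inj ((spec l).symm.trans ((h G β).trans (spec m)))
    map_oplus := by
      rintro ⟨l⟩ ⟨m⟩ ⟨n⟩ h
      have := (tensor_oplus _ _ _).1 h G β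
      rw [spec n] at this
      obtain ⟨x, y, hx, hy, hxy⟩ := β.eval_append_some.1 this
      cases (spec l).symm.trans hx
      cases (spec m).symm.trans hy
      exact hxy
    map_one := Option.some.inj ((spec _).symm.trans β.eval_unit) }

theorem tensorLift_tmul {E F G : EA.{u}} (β : Bihom E F G) (a : E) (b : F) :
    (tensorLift β).toFun ((tmul E F).toFun a b) = β.toFun a b :=
  Option.some.inj
    (((TensorPre.simple a b).exists_eval β).choose_spec.symm.trans (β.eval_singleton a b))

theorem tensor_osum {E F : EA.{u}} (l : TensorPre E F) :
    (tmul E F).eval l.list = some (_root_.Quotient.mk (tensorSetoid E F) l) := by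
  obtain ⟨l, hl⟩ := l
  induction l with
  | nil => rfl
  | cons p l ih =>
    have hl' : ∃ m, ∀ (G : EA.{u}) (β : Bihom E F G), β.eval (l ++ m) = some G.one := by
      obtain ⟨m, hm⟩ := hl
      refine ⟨m ++ [p], fun G β => ?_⟩
      rw [← hm G β, ← List.append_assoc, β.eval_append_comm]
      rfl
    refine ((tmul E F).eval_append_some (l := [p]) (m := l)).2 ⟨_, _, Bihom.eval_singleton _ _ _, ih hl',
      (tensor_oplus _ _ _).2 fun G β => rfl⟩

theorem tensor_hom_ext {E F G : EA.{u}} {f g : tensor E F ⟶ G}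
    (h : ∀ a b, f.toFun ((tmul E F).toFun a b) = g.toFun ((tmul E F).toFun a b)) : f = g := by
  have key : ∀ (k : tensor E F ⟶ G) (l : List (E × F)) (s : tensor E F),
      (tmul E F).eval l = some s →
        G.osum (l.map fun p => k.toFun ((tmul E F).toFun p.1 p.2)) = some (k.toFun s) := by
    intro k l
    induction l with
    | nil =>
      intro s hs
      cases hs
      exact congrArg some k.map_zero.symm
    | cons p l ih =>
      intro s hs
      obtain ⟨t, ht, hts⟩ := Option.bind_eq_some_iff.1
        (hs : (((tmul E F).eval l).bind fun t => _) = some s)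
      refine Option.bind_eq_some_iff.2 ⟨_, ih t ht, k.map_oplus _ _ _ hts⟩
  refine hom_ext ?_
  rintro ⟨l⟩
  have e1 := key f l.list _ (tensor_osum l)
  have e2 := key g l.list _ (tensor_osum l)
  simp only [h] at e1
  exact Option.some.inj (e1.symm.trans e2)

/-- The universal property of the tensor product of effect algebras. -/
theorem tensor_universal {E F G : EA.{u}} (β : Bihom E F G) :
    ∃! f : tensor E F ⟶ G, ∀ a b, f.toFun ((tmul E F).toFun a b) = β.toFun a b :=
  ⟨tensorLift β, tensorLift_tmul β, fun _ hf =>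
    tensor_hom_ext fun a b => (hf a b).trans (tensorLift_tmul β a b).symm⟩

/-- `E ⊗ g : E ⊗ F → E ⊗ F'`. -/
noncomputable def tensorMap (E : EA.{u}) {F F' : EA.{u}} (g : F ⟶ F') :
    tensor E F ⟶ tensor E F' :=
  tensorLift
    { toFun := fun a b => (tmul E F').toFun a (g.toFun b)
      map_oplus_left := fun a a' c b h => (tmul E F').map_oplus_left a a' c _ h
      map_oplus_right := fun a b b' c h =>
        (tmul E F').map_oplus_right a _ _ _ (g.map_oplus b b' c h)
      map_one_one := by rw [g.map_one, (tmul E F').map_one_one] }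

theorem tensorMap_tmul (E : EA.{u}) {F F' : EA.{u}} (g : F ⟶ F') (a : E) (b : F) :
    (tensorMap E g).toFun ((tmul E F).toFun a b) = (tmul E F').toFun a (g.toFun b) :=
  tensorLift_tmul _ a b

/-- The homomorphism `ι : E → E ⊗ F`, `a ↦ a ⊗ 1`. -/
noncomputable def tensorInl (E F : EA.{u}) : E ⟶ tensor E F :=
  ({ toFun := fun a => (tmul E F).toFun a F.one
     map_oplus := fun a b c h => (tmul E F).map_oplus_left a b c _ h
     map_one := (tmul E F).map_one_one } : Hom E (tensor E F))

/-- The functor `E ⊗ -` from `EA` to `E ↓ EA`, sending `F` to `ι : E → E ⊗ F`. -/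
noncomputable def tensorFunctor (E : EA.{u}) : EA.{u} ⥤ Under E where
  obj F := Under.mk (tensorInl E F)
  map {F F'} g := Under.homMk (tensorMap E g) (hom_ext fun a =>
    (tensorMap_tmul E g a F.one).trans (congrArg ((tmul E F').toFun a) g.map_one))
  map_id F := Under.UnderMorphism.ext (tensor_hom_ext fun a b => tensorMap_tmul E (𝟙 F) a b)
  map_comp g k := Under.UnderMorphism.ext (tensor_hom_ext fun a b =>
    (tensorMap_tmul E (g ≫ k) a b).trans
      ((congrArg (tensorMap E k).toFun (tensorMap_tmul E g a b)).trans
        (tensorMap_tmul E k a (g.toFun b))).symm)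

end EA

/-! ## Unital Abelian po-groups -/

/-- A unital Abelian po-group: a partially ordered Abelian group with a distinguished order unit. -/
structure POGu : Type (u + 1) where
  carrier : Type u
  [group : AddCommGroup carrier]
  [order : PartialOrder carrier]
  [ordered : IsOrderedAddMonoid carrier]
  unit : carrier
  unit_nonneg : 0 ≤ unit
  exists_le_nsmul_unit : ∀ x : carrier, ∃ n : ℕ, x ≤ n • unit

namespace POGu

instance : CoeSort POGu.{u} (Type u) := ⟨POGu.carrier⟩

attribute [instance] POGu.group POGu.order POGu.ordered

/-- A homomorphism of unital Abelian po-groups: a positive group homomorphism preserving the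
distinguished order units. -/
@[ext]
structure Hom (A B : POGu.{u}) : Type u where
  toFun : A →+ B
  map_nonneg : ∀ a, 0 ≤ a → 0 ≤ toFun a
  map_unit : toFun A.unit = B.unit

instance : Category POGu.{u} where
  Hom := Hom
  id A := { toFun := AddMonoidHom.id A, map_nonneg := fun _ h => h, map_unit := rfl }
  comp f g :=
    { toFun := g.toFun.comp f.toFun
      map_nonneg := fun a h => g.map_nonneg _ (f.map_nonneg a h)
      map_unit := (congrArg g.toFun f.map_unit).trans g.map_unit }

theorem hom_ext {A B : POGu.{u}} {f g : A ⟶ B} (h : ∀ a, f.toFun a = g.toFun a) : f = g :=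
  Hom.ext (AddMonoidHom.ext h)

theorem exists_sub (A : POGu.{u}) (a : A) :
    ∃ p q : A, 0 ≤ p ∧ 0 ≤ q ∧ a = p - q := by
  obtain ⟨n, hn⟩ := A.exists_le_nsmul_unit a
  exact ⟨n • A.unit, n • A.unit - a, nsmul_nonneg A.unit_nonneg n, sub_nonneg.2 hn, by abel⟩

/-! ### The po-group `[A, B]_h` -/

/-- A positive homomorphism of po-groups. -/
def IsPos {A B : POGu.{u}} (f : A →+ B) : Prop := ∀ a, 0 ≤ a → 0 ≤ f a

theorem IsPos.antisymm {A B : POGu.{u}} {f : A →+ B} (h : IsPos f) (h' : IsPos (-f)) : f = 0 := by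
  ext a
  have key : ∀ p : A, 0 ≤ p → f p = 0 := fun p hp =>
    le_antisymm (by simpa using h' p hp) (h p hp)
  obtain ⟨p, q, hp, hq, rfl⟩ := A.exists_sub a
  simp [key p hp, key q hq]

/-- The maximal subgroup of the group of homomorphisms `A → B` (ordered by the cone of positive
homomorphisms) in which `h` is an order unit. -/
def boundedSubgroup {A B : POGu.{u}} (h : A ⟶ B) : AddSubgroup (A →+ B) where
  carrier := {f | (∃ n : ℕ, IsPos (n • h.toFun - f)) ∧ ∃ n : ℕ, IsPos (n • h.toFun + f)}
  zero_mem' := ⟨⟨0, fun a _ => by simp⟩, ⟨0, fun a _ => by simp⟩⟩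
  add_mem' := by
    rintro f g ⟨⟨n, hn⟩, n', hn'⟩ ⟨⟨m, hm⟩, m', hm'⟩
    refine ⟨⟨n + m, fun a ha => ?_⟩, ⟨n' + m', fun a ha => ?_⟩⟩
    · have e := add_nonneg (hn a ha) (hm a ha)
      have : ((n + m) • h.toFun - (f + g)) a
          = (n • h.toFun - f) a + (m • h.toFun - g) a := by
        simp [add_smul]; abel
      rwa [this]
    · have e := add_nonneg (hn' a ha) (hm' a ha)
      have : ((n' + m') • h.toFun + (f + g)) a
          = (n' • h.toFun + f) a + (m' • h.toFun + g) a := by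
        simp [add_smul]; abel
      rwa [this]
  neg_mem' := by
    rintro f ⟨⟨n, hn⟩, m, hm⟩
    exact ⟨⟨m, by rwa [sub_neg_eq_add]⟩, ⟨n, by rwa [← sub_eq_add_neg]⟩⟩

/-- The unital po-group `[A, B]_h`, with order unit `h`; here `f ≤ g` means that `g - f` is a
positive homomorphism. -/
def homBounded {A B : POGu.{u}} (h : A ⟶ B) : POGu.{u} :=
  letI : PartialOrder (boundedSubgroup h) :=
    { le := fun f g => IsPos (g.1 - f.1)
      le_refl := fun f a _ => by simp
      le_trans := fun f g k h1 h2 a ha => by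
        have e := add_nonneg (h1 a ha) (h2 a ha)
        have : (k.1 - f.1) a = (g.1 - f.1) a + (k.1 - g.1) a := by simp
        rwa [this]
      le_antisymm := fun f g h1 h2 => by
        have := h1.antisymm (by rwa [neg_sub])
        exact Subtype.ext (sub_eq_zero.1 this).symm }
  letI : IsOrderedAddMonoid (boundedSubgroup h) :=
    { add_le_add_left := fun f g hfg k a ha => by
        have e := hfg a ha
        have : ((g + k).1 - (f + k).1) a = (g.1 - f.1) a := by simp
        rwa [this] }
  { carrier := boundedSubgroup h
    unit := ⟨h.toFun, ⟨1, fun a _ => by simp⟩, ⟨0, fun a ha => by simpa using h.map_nonneg a ha⟩⟩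
    unit_nonneg := fun a ha => by simpa using h.map_nonneg a ha
    exists_le_nsmul_unit := fun f => by
      obtain ⟨n, hn⟩ := f.2.1
      exact ⟨n, hn⟩ }

theorem homBounded_nonneg {A B : POGu.{u}} {h : A ⟶ B} (f : boundedSubgroup h) :
    (0 : homBounded h) ≤ (f : homBounded h) ↔ IsPos f.1 :=
  Iff.of_eq (congrArg IsPos (sub_zero f.1))

/-- The functor `[A, -]_-` from `A ↓ POGu` to `POGu`, sending `h : A → B` to `[A, B]_h` and acting
on morphisms by composition. -/
def homFunctor (A : POGu.{u}) : Under A ⥤ POGu.{u} where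
  obj h := homBounded h.hom
  map {h h'} k :=
    have comp_hom : k.right.toFun.comp h.hom.toFun = h'.hom.toFun :=
      congrArg Hom.toFun (Under.w k)
    have pos : ∀ {f : A →+ h.right}, IsPos f → IsPos (k.right.toFun.comp f) :=
      fun hf a ha => k.right.map_nonneg _ (hf a ha)
    { toFun :=
        { toFun := fun f : boundedSubgroup h.hom =>
            (⟨k.right.toFun.comp f.1, by
              obtain ⟨⟨n, hn⟩, m, hm⟩ := f.2
              refine ⟨⟨n, ?_⟩, ⟨m, ?_⟩⟩
              · rw [← comp_hom]
                convert pos hn using 1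
                ext a
                simp
              · rw [← comp_hom]
                convert pos hm using 1
                ext a
                simp⟩ : boundedSubgroup h'.hom)
          map_zero' := Subtype.ext (by ext a; exact map_zero k.right.toFun)
          map_add' := fun f g => Subtype.ext (by ext a; exact map_add k.right.toFun _ _) }
      map_nonneg := fun f hf =>
        (homBounded_nonneg _).2 (pos ((homBounded_nonneg _).1 hf))
      map_unit := Subtype.ext comp_hom }
  map_id _ := rfl
  map_comp _ _ := rfl

/-! ### The tensor product of unital Abelian po-groups -/

/-- A bihomomorphism of unital Abelian po-groups. -/
structure Bihom (A B C : POGu.{u}) : Type u where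
  toFun : A →+ B →+ C
  map_nonneg : ∀ a b, 0 ≤ a → 0 ≤ b → 0 ≤ toFun a b
  map_unit : toFun A.unit B.unit = C.unit

/-- The cone of `A ⊗ B`: all finite sums of tensors `a ⊗ b` with `a, b ≥ 0`. -/
def tensorCone (A B : POGu.{u}) : AddSubmonoid (A ⊗[ℤ] B) :=
  AddSubmonoid.closure {x | ∃ a b, 0 ≤ a ∧ 0 ≤ b ∧ x = a ⊗ₜ b}

theorem tmul_mem_tensorCone {A B : POGu.{u}} {a : A} {b : B} (ha : 0 ≤ a) (hb : 0 ≤ b) :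
    a ⊗ₜ[ℤ] b ∈ tensorCone A B :=
  AddSubmonoid.subset_closure ⟨a, b, ha, hb, rfl⟩

theorem exists_pos_functional {V : Type*} [AddCommGroup V] [Module ℚ V] (n : ℕ) (a : Fin n → V)
    (h : ∀ c : Fin n → ℚ, (∀ i, 0 ≤ c i) → ∑ i, c i • a i = 0 → ∀ i, c i = 0) :
    ∃ f : V →ₗ[ℚ] ℚ, ∀ i, 0 < f (a i) := by
  induction n with
  | zero => exact ⟨0, fun i => i.elim0⟩
  | succ n ih =>
    obtain ⟨f, hf⟩ := ih (fun i => a i.castSucc) (by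
      intro c hc hs i
      have := h (Fin.snoc c 0) (fun i => by
        refine Fin.lastCases ?_ (fun j => ?_) i
        · simp
        · simpa using hc j) (by simpa [Fin.sum_univ_castSucc] using hs) i.castSucc
      simpa using this)
    set x := a (Fin.last n) with hx
    by_cases hfx : 0 < f x
    · exact ⟨f, fun i => Fin.lastCases hfx hf i⟩
    have hfx : f x ≤ 0 := not_lt.mp hfx
    have hx0 : x ≠ 0 := by
      intro h0
      have := h (Fin.snoc (fun _ => 0) 1) (fun i => by
        refine Fin.lastCases ?_ (fun j => ?_) i <;> simp) (by
          simp [Fin.sum_univ_castSucc, ← hx, h0]) (Fin.last n)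
      simp at this
    rcases Nat.eq_zero_or_pos n with rfl | hn
    · obtain ⟨g, hg⟩ : ∃ g : V →ₗ[ℚ] ℚ, g x ≠ 0 := by
        by_contra! hall
        exact hx0 ((Module.forall_dual_apply_eq_zero_iff ℚ x).1 hall)
      rcases hg.lt_or_gt with h1 | h1
      · exact ⟨-g, fun i => by rw [Fin.fin_one_eq_zero i]; simpa [hx] using h1⟩
      · exact ⟨g, fun i => by rw [Fin.fin_one_eq_zero i]; simpa [hx] using h1⟩
    obtain ⟨g, hg⟩ := ih (fun i => f (a i.castSucc) • x - f x • a i.castSucc) (by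
      intro c hc hs i
      have := h (Fin.snoc (fun i => - f x * c i) (∑ i, c i * f (a i.castSucc))) (fun i => by
        refine Fin.lastCases ?_ (fun j => ?_) i
        · simpa using Finset.sum_nonneg fun i _ => mul_nonneg (hc i) (hf i).le
        · have := mul_nonneg (neg_nonneg.2 hfx) (hc j)
          simpa using this) (by
        rw [← hs]
        simp only [Fin.sum_univ_castSucc, Fin.snoc_castSucc, Fin.snoc_last, Finset.sum_smul, ← hx,
          ← Finset.sum_add_distrib]
        refine Finset.sum_congr rfl fun i _ => ?_
        module) (Fin.last n)
      simp only [Fin.snoc_last] at this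
      rw [Finset.sum_eq_zero_iff_of_nonneg fun i _ => mul_nonneg (hc i) (hf i).le] at this
      have := this i (Finset.mem_univ _)
      exact (mul_eq_zero.1 this).resolve_right (hf i).ne')
    have hg' : ∀ i : Fin n, 0 < f (a i.castSucc) * g x - f x * g (a i.castSucc) := by
      intro i; simpa using hg i
    have : Nonempty (Fin n) := ⟨⟨0, hn⟩⟩
    obtain ⟨i₀, -, hi₀⟩ := Finset.exists_max_image (Finset.univ : Finset (Fin n))
      (fun i => - g (a i.castSucc) / f (a i.castSucc)) Finset.univ_nonempty
    obtain ⟨t, ht1, ht2⟩ : ∃ t : ℚ, - g (a i₀.castSucc) / f (a i₀.castSucc) < t ∧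
        0 < g x + t * f x := by
      rcases hfx.lt_or_eq with hlt | heq
      · obtain ⟨t, h1, h2⟩ := exists_between (a₁ := - g (a i₀.castSucc) / f (a i₀.castSucc))
          (a₂ := g x / (- f x)) (by
            rw [div_lt_div_iff₀ (hf i₀) (by linarith)]
            have := hg' i₀
            nlinarith)
        refine ⟨t, h1, ?_⟩
        rw [lt_div_iff₀ (by linarith)] at h2
        linarith
      · obtain ⟨t, ht⟩ := exists_gt (- g (a i₀.castSucc) / f (a i₀.castSucc))
        refine ⟨t, ht, ?_⟩
        have := hg' i₀
        rw [heq] at this ⊢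
        have := (pos_iff_pos_of_mul_pos (by linarith : 0 < f (a i₀.castSucc) * g x)).1 (hf i₀)
        linarith
    refine ⟨g + t • f, fun i => Fin.lastCases ?_ (fun i => ?_) i⟩
    · simpa using ht2
    · have h1 := (hi₀ i (Finset.mem_univ _)).trans_lt ht1
      rw [div_lt_iff₀ (hf i)] at h1
      simp
      linarith

theorem exists_pos_hom {A : Type*} [AddCommGroup A] [PartialOrder A] [IsOrderedAddMonoid A]
    (n : ℕ) (a : Fin n → A) (ha : ∀ i, 0 < a i) : ∃ f : A →+ ℚ, ∀ i, 0 < f (a i) := by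
  obtain ⟨f, hf⟩ := exists_pos_functional (V := ℚ ⊗[ℤ] A) n (fun i => 1 ⊗ₜ a i) (by
    intro c hc hs i
    set d : ℕ := ∏ j, (c j).den with hd
    have hd0 : 0 < d := Finset.prod_pos fun j _ => (c j).pos
    have hk : ∀ j, ∃ k : ℕ, (d : ℚ) * c j = k := by
      intro j
      obtain ⟨e, he⟩ : (c j).den ∣ d := Finset.dvd_prod_of_mem _ (Finset.mem_univ j)
      refine ⟨(c j).num.toNat * e, ?_⟩
      have h1 : ((c j).num.toNat : ℚ) = (c j).num := by
        exact_mod_cast congrArg (Int.cast (R := ℚ)) (Int.toNat_of_nonneg (Rat.num_nonneg.2 (hc j)))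
      rw [he]; push_cast
      rw [h1, ← Rat.mul_den_eq_num (c j)]; ring
    choose k hk using hk
    have h1 : (1 : ℚ) ⊗ₜ[ℤ] (∑ j, k j • a j) = 0 := by
      have := congrArg (fun z => (d : ℚ) • z) hs
      simp only [smul_zero, Finset.smul_sum, smul_smul, hk] at this
      rw [← this, TensorProduct.tmul_sum]
      refine Finset.sum_congr rfl fun j _ => ?_
      rw [TensorProduct.tmul_smul, Nat.cast_smul_eq_nsmul]
    rw [← TensorProduct.mk_apply, IsLocalizedModule.eq_zero_iff (nonZeroDivisors ℤ)] at h1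
    obtain ⟨m, hm⟩ := h1
    have hm0 : (m : ℤ) ≠ 0 := nonZeroDivisors.ne_zero m.2
    have h2 : (m : ℤ).natAbs • (∑ j, k j • a j) = 0 := by
      have h3 : (m : ℤ) • (∑ j, k j • a j) = 0 := hm
      rcases Int.natAbs_eq (m : ℤ) with h | h <;> rw [h] at h3
      · simpa using h3
      · simpa using h3
    rw [Finset.smul_sum, Finset.sum_eq_zero_iff_of_nonneg
      fun j _ => nsmul_nonneg (nsmul_nonneg (ha j).le _) _] at h2
    have h3 := h2 i (Finset.mem_univ _)
    rw [smul_smul] at h3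
    by_contra hci
    have : 0 < (m : ℤ).natAbs * k i := by
      refine Nat.mul_pos (Int.natAbs_pos.2 hm0) (Nat.pos_of_ne_zero fun h0 => hci ?_)
      have := hk i
      rw [h0] at this
      simpa [hd0.ne'] using this
    exact (nsmul_pos (ha i) this.ne').ne' h3)
  exact ⟨f.toAddMonoidHom.comp (TensorProduct.mk ℤ ℚ A 1).toAddMonoidHom, hf⟩

theorem exists_list_of_mem_tensorCone {A B : POGu.{u}} {x : A ⊗[ℤ] B} (hx : x ∈ tensorCone A B) :
    ∃ l : List (A × B), (∀ p ∈ l, 0 < p.1 ∧ 0 < p.2) ∧ x = (l.map fun p => p.1 ⊗ₜ p.2).sum := by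
  induction hx using AddSubmonoid.closure_induction with
  | mem x hx =>
    obtain ⟨a, b, ha, hb, rfl⟩ := hx
    rcases ha.eq_or_lt with rfl | ha
    · exact ⟨[], by simp, by simp⟩
    rcases hb.eq_or_lt with rfl | hb
    · exact ⟨[], by simp, by simp⟩
    exact ⟨[(a, b)], by simp [ha, hb], by simp⟩
  | zero => exact ⟨[], by simp, by simp⟩
  | add x y _ _ hx hy =>
    obtain ⟨l, hl, rfl⟩ := hx
    obtain ⟨m, hm, rfl⟩ := hy
    refine ⟨l ++ m, fun p hp => ?_, by simp⟩
    rcases List.mem_append.1 hp with h | h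
    · exact hl p h
    · exact hm p h

theorem tensorCone_strict {A B : POGu.{u}} {x : A ⊗[ℤ] B} (hx : x ∈ tensorCone A B)
    (hx' : -x ∈ tensorCone A B) : x = 0 := by
  obtain ⟨l, hl, rfl⟩ := exists_list_of_mem_tensorCone hx
  obtain ⟨m, hm, hlm⟩ := exists_list_of_mem_tensorCone hx'
  have hpos : ∀ p ∈ l ++ m, 0 < p.1 ∧ 0 < p.2 := fun p hp =>
    (List.mem_append.1 hp).elim (hl p) (hm p)
  obtain ⟨f, hf⟩ := exists_pos_hom _ (fun i => ((l ++ m).get i).1)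
    fun i => (hpos _ (List.get_mem _ i)).1
  obtain ⟨g, hg⟩ := exists_pos_hom _ (fun i => ((l ++ m).get i).2)
    fun i => (hpos _ (List.get_mem _ i)).2
  have hfg : ∀ p ∈ l ++ m, 0 < f p.1 * g p.2 := by
    intro p hp
    obtain ⟨i, rfl⟩ := List.get_of_mem hp
    exact mul_pos (hf i) (hg i)
  have hsum : ((l ++ m).map fun p => p.1 ⊗ₜ[ℤ] p.2).sum = 0 := by
    rw [List.map_append, List.sum_append, ← hlm, add_neg_cancel]
  let φ : A ⊗[ℤ] B →ₗ[ℤ] ℚ :=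
    LinearMap.mul' ℤ ℚ ∘ₗ TensorProduct.map f.toIntLinearMap g.toIntLinearMap
  have h0 := congrArg φ hsum
  rw [map_list_sum, map_zero, List.map_map] at h0
  have hnil : l ++ m = [] := by
    by_contra hne
    refine (List.sum_pos _ ?_ (by simpa using hne)).ne' h0
    intro q hq
    obtain ⟨p, hp, rfl⟩ := List.mem_map.1 hq
    exact hfg p hp
  rw [(List.append_eq_nil_iff.1 hnil).1]
  rfl

/-- The tensor product of unital Abelian po-groups: the tensor product of the underlying Abelian
groups, with the cone of all sums of tensors of positive elements and the order unit `u ⊗ v`. -/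
noncomputable def tensor (A B : POGu.{u}) : POGu.{u} :=
  letI : PartialOrder (A ⊗[ℤ] B) :=
    { le := fun x y => y - x ∈ tensorCone A B
      le_refl := fun x => by simp [(tensorCone A B).zero_mem]
      le_trans := fun x y z h1 h2 => by
        have := (tensorCone A B).add_mem h1 h2
        rwa [sub_add_sub_cancel'] at this
      le_antisymm := fun x y h1 h2 =>
        (sub_eq_zero.1 (tensorCone_strict h1 (by rwa [neg_sub]))).symm }
  letI : IsOrderedAddMonoid (A ⊗[ℤ] B) :=
    { add_le_add_left := fun x y h z => by
        change _ ∈ _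
        rwa [add_sub_add_right_eq_sub] }
  { carrier := A ⊗[ℤ] B
    unit := A.unit ⊗ₜ B.unit
    unit_nonneg := by
      change _ - _ ∈ _
      rw [sub_zero]
      exact tmul_mem_tensorCone A.unit_nonneg B.unit_nonneg
    exists_le_nsmul_unit := fun x => by
      have key : ∀ (a : A) (b : B), 0 ≤ a → 0 ≤ b →
          ∃ n : ℕ, n • (A.unit ⊗ₜ[ℤ] B.unit) - a ⊗ₜ[ℤ] b ∈ tensorCone A B := by
        intro a b ha hb
        obtain ⟨n, hn⟩ := A.exists_le_nsmul_unit a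
        obtain ⟨m, hm⟩ := B.exists_le_nsmul_unit b
        refine ⟨n * m, ?_⟩
        have e : (n * m) • (A.unit ⊗ₜ[ℤ] B.unit) - a ⊗ₜ[ℤ] b
            = (n • A.unit - a) ⊗ₜ[ℤ] (m • B.unit) + a ⊗ₜ[ℤ] (m • B.unit - b) := by
          rw [TensorProduct.sub_tmul, TensorProduct.tmul_sub]
          simp only [← natCast_zsmul, TensorProduct.smul_tmul', TensorProduct.tmul_smul, smul_smul]
          push_cast
          rw [mul_comm (m : ℤ)]
          abel
        rw [e]
        exact add_mem (tmul_mem_tensorCone (sub_nonneg.2 hn) (nsmul_nonneg B.unit_nonneg m))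
          (tmul_mem_tensorCone ha (sub_nonneg.2 hm))
      change ∃ n : ℕ, n • (A.unit ⊗ₜ[ℤ] B.unit) - x ∈ tensorCone A B
      induction x using TensorProduct.induction_on with
      | zero => exact ⟨0, by simp [(tensorCone A B).zero_mem]⟩
      | tmul a b =>
        obtain ⟨p, q, hp, hq, rfl⟩ := A.exists_sub a
        obtain ⟨r, s, hr, hs, rfl⟩ := B.exists_sub b
        obtain ⟨n, hn⟩ := key p r hp hr
        obtain ⟨m, hm⟩ := key q s hq hs
        refine ⟨n + m, ?_⟩
        have e : (n + m) • (A.unit ⊗ₜ[ℤ] B.unit) - (p - q) ⊗ₜ[ℤ] (r - s)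
            = (n • (A.unit ⊗ₜ[ℤ] B.unit) - p ⊗ₜ[ℤ] r) +
              (m • (A.unit ⊗ₜ[ℤ] B.unit) - q ⊗ₜ[ℤ] s) + p ⊗ₜ[ℤ] s + q ⊗ₜ[ℤ] r := by
          rw [TensorProduct.sub_tmul, TensorProduct.tmul_sub, TensorProduct.tmul_sub, add_smul]
          abel
        rw [e]
        exact add_mem (add_mem (add_mem hn hm) (tmul_mem_tensorCone hp hs))
          (tmul_mem_tensorCone hq hr)
      | add x y hx hy =>
        obtain ⟨n, hn⟩ := hx
        obtain ⟨m, hm⟩ := hy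
        refine ⟨n + m, ?_⟩
        have := add_mem hn hm
        rwa [sub_add_sub_comm, ← add_smul] at this }

theorem tensor_nonneg {A B : POGu.{u}} (x : A ⊗[ℤ] B) :
    (0 : tensor A B) ≤ (x : tensor A B) ↔ x ∈ tensorCone A B := by
  exact Iff.of_eq (congrArg (· ∈ tensorCone A B) (sub_zero x))

/-- The universal bihomomorphism `A × B → A ⊗ B`. -/
noncomputable def tmul (A B : POGu.{u}) : Bihom A B (tensor A B) where
  toFun := AddMonoidHom.mk' (fun a => (AddMonoidHom.mk' (fun b => a ⊗ₜ[ℤ] b)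
      fun b b' => TensorProduct.tmul_add a b b' : B →+ A ⊗[ℤ] B))
    fun a a' => AddMonoidHom.ext fun b => TensorProduct.add_tmul a a' b
  map_nonneg _ _ ha hb := (tensor_nonneg _).2 (tmul_mem_tensorCone ha hb)
  map_unit := rfl

/-- The homomorphism `A ⊗ B → C` induced by a bihomomorphism. -/
noncomputable def tensorLift {A B C : POGu.{u}} (β : Bihom A B C) : tensor A B ⟶ C :=
  ({ toFun := (TensorProduct.liftAddHom β.toFun fun r a b => by simp : A ⊗[ℤ] B →+ C)
     map_nonneg := fun x hx => by
      replace hx : x ∈ tensorCone A B := (tensor_nonneg x).1 hx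
      induction hx using AddSubmonoid.closure_induction with
      | mem x hx =>
        obtain ⟨a, b, ha, hb, rfl⟩ := hx
        exact β.map_nonneg a b ha hb
      | zero => exact (map_zero _).ge
      | add x y _ _ hx hy => exact (add_nonneg hx hy).trans (map_add _ _ _).ge
     map_unit := β.map_unit } : Hom (tensor A B) C)

theorem tensorLift_tmul {A B C : POGu.{u}} (β : Bihom A B C) (a : A) (b : B) :
    (tensorLift β).toFun ((tmul A B).toFun a b) = β.toFun a b := rfl

theorem tensor_hom_ext {A B C : POGu.{u}} {f g : tensor A B ⟶ C}
    (h : ∀ a b, f.toFun ((tmul A B).toFun a b) = g.toFun ((tmul A B).toFun a b)) : f = g := by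
  refine hom_ext fun (x : A ⊗[ℤ] B) => ?_
  induction x using TensorProduct.induction_on with
  | zero => exact (map_zero f.toFun).trans (map_zero g.toFun).symm
  | tmul a b => exact h a b
  | add x y hx hy =>
    exact (map_add f.toFun _ _).trans ((congrArg₂ _ hx hy).trans (map_add g.toFun _ _).symm)

/-- The universal property of the tensor product of unital Abelian po-groups. -/
theorem tensor_universal {A B C : POGu.{u}} (β : Bihom A B C) :
    ∃! f : tensor A B ⟶ C, ∀ a b, f.toFun ((tmul A B).toFun a b) = β.toFun a b :=
  ⟨tensorLift β, tensorLift_tmul β, fun _ hf =>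
    tensor_hom_ext fun a b => (hf a b).trans (tensorLift_tmul β a b).symm⟩

/-- `A ⊗ g : A ⊗ B → A ⊗ B'`. -/
noncomputable def tensorMap (A : POGu.{u}) {B B' : POGu.{u}} (g : B ⟶ B') :
    tensor A B ⟶ tensor A B' :=
  tensorLift
    { toFun := (AddMonoidHom.compHom.flip g.toFun).comp (tmul A B').toFun
      map_nonneg := fun a b ha hb => (tmul A B').map_nonneg a _ ha (g.map_nonneg b hb)
      map_unit := (congrArg ((tmul A B').toFun A.unit) g.map_unit).trans (tmul A B').map_unit }

theorem tensorMap_tmul (A : POGu.{u}) {B B' : POGu.{u}} (g : B ⟶ B') (a : A) (b : B) :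
    (tensorMap A g).toFun ((tmul A B).toFun a b) = (tmul A B').toFun a (g.toFun b) := rfl

/-- The homomorphism `ι : A → A ⊗ B`, `a ↦ a ⊗ v`, where `v` is the order unit of `B`. -/
noncomputable def tensorInl (A B : POGu.{u}) : A ⟶ tensor A B :=
  ({ toFun := (tmul A B).toFun.flip B.unit
     map_nonneg := fun a ha => (tmul A B).map_nonneg a _ ha B.unit_nonneg
     map_unit := rfl } : Hom A (tensor A B))

/-- The functor `A ⊗ -` from `POGu` to `A ↓ POGu`, sending `B` to `ι : A → A ⊗ B`. -/
noncomputable def tensorFunctor (A : POGu.{u}) : POGu.{u} ⥤ Under A where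
  obj B := Under.mk (tensorInl A B)
  map {_ B'} g := Under.homMk (tensorMap A g) (hom_ext fun a =>
    congrArg ((tmul A B').toFun a) g.map_unit)
  map_id _ := Under.UnderMorphism.ext (tensor_hom_ext fun _ _ => rfl)
  map_comp _ _ := Under.UnderMorphism.ext (tensor_hom_ext fun _ _ => rfl)

end POGu

/-! ## The adjoint pair `Gr ⊣ Γ` -/

namespace POGu

/-- The effect algebra `Γ(A, u)` on the interval `[0, u]`, where `a ⊕ b = c` if and only if
`a + b = c`. -/
noncomputable def interval (A : POGu.{u}) : EA.{u} := EA.ofGraph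
  { S := fun a b c : {x : A // 0 ≤ x ∧ x ≤ A.unit} => a.1 + b.1 = c.1
    zero := ⟨0, le_rfl, A.unit_nonneg⟩
    one := ⟨A.unit, A.unit_nonneg, le_rfl⟩
    func := fun h1 h2 => Subtype.ext (h1.symm.trans h2)
    comm := fun h => (add_comm _ _).trans h
    assoc := fun {a b c x y} h1 h2 =>
      have e : a.1 + (b.1 + c.1) = y.1 := by rw [← add_assoc, h1, h2]
      ⟨⟨b.1 + c.1, add_nonneg b.2.1 c.2.1,
        ((le_add_of_nonneg_left a.2.1).trans e.le).trans y.2.2⟩, rfl, e⟩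
    compl := fun a => ⟨⟨A.unit - a.1, sub_nonneg.2 a.2.2, sub_le_self _ a.2.1⟩,
      add_sub_cancel _ _, fun b h => Subtype.ext (eq_sub_of_add_eq' h)⟩
    one_right := fun {a c} h => Subtype.ext (le_antisymm
      (le_of_add_le_add_right (h.le.trans (c.2.2.trans (zero_add _).ge))) a.2.1)
    zero_one := zero_add _ }

theorem interval_oplus {A : POGu.{u}} (a b c : {x : A // 0 ≤ x ∧ x ≤ A.unit}) :
    A.interval.oplus a b = some c ↔ a.1 + b.1 = c.1 :=
  EA.Graph.op_eq_some _ _ _ _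

theorem Hom.map_mono {A B : POGu.{u}} (f : A ⟶ B) {a b : A} (h : a ≤ b) :
    f.toFun a ≤ f.toFun b := by
  have := f.map_nonneg _ (sub_nonneg.2 h)
  rwa [map_sub, sub_nonneg] at this

end POGu

/-- The functor `Γ`, sending `(A, u)` to `Γ(A, u)` and acting on morphisms by restriction. -/
noncomputable def Gam : POGu.{u} ⥤ EA.{u} where
  obj A := A.interval
  map {A B} f :=
    ({ toFun := fun a : {x : A // 0 ≤ x ∧ x ≤ A.unit} =>
        (⟨f.toFun a.1, f.map_nonneg _ a.2.1,
          (POGu.Hom.map_mono f a.2.2).trans f.map_unit.le⟩ : {x : B // 0 ≤ x ∧ x ≤ B.unit})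
       map_oplus := fun a b c h => (POGu.interval_oplus _ _ _).2
        ((map_add f.toFun _ _).symm.trans (congrArg f.toFun ((POGu.interval_oplus a b c).1 h)))
       map_one := Subtype.ext f.map_unit } : EA.Hom A.interval B.interval)
  map_id _ := rfl
  map_comp _ _ := rfl

namespace EA

/-- The cone of the smallest preorder on the free Abelian group over `E` that makes it a preordered
group, in which all generators are positive and in which the generator `c` is equivalent to the sum
of the generators `a` and `b` whenever `a ⊕ b = c`. -/
def grCone (E : EA.{u}) : AddSubmonoid (FreeAbelianGroup E) :=
  AddSubmonoid.closure
    ({x | ∃ a, x = FreeAbelianGroup.of a} ∪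
      {x | ∃ a b c, E.oplus a b = some c ∧
        (x = .of c - (.of a + .of b) ∨ x = .of a + .of b - .of c)})

/-- The elements of the free Abelian group over `E` that are equivalent to `0`. -/
def grKer (E : EA.{u}) : AddSubgroup (FreeAbelianGroup E) where
  carrier := {x | x ∈ E.grCone ∧ -x ∈ E.grCone}
  zero_mem' := ⟨zero_mem _, by rw [neg_zero]; exact zero_mem _⟩
  add_mem' h h' := ⟨add_mem h.1 h'.1, by rw [neg_add]; exact add_mem h.2 h'.2⟩
  neg_mem' h := ⟨h.2, by rw [neg_neg]; exact h.1⟩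

/-- The underlying group of the universal group of `E`. -/
abbrev GrCarrier (E : EA.{u}) : Type u := FreeAbelianGroup E ⧸ E.grKer

theorem of_mem_grCone (E : EA.{u}) (a : E) : FreeAbelianGroup.of a ∈ E.grCone :=
  AddSubmonoid.subset_closure (Or.inl ⟨a, rfl⟩)

theorem rel_mem_grKer (E : EA.{u}) {a b c : E} (h : E.oplus a b = some c) :
    FreeAbelianGroup.of a + .of b - .of c ∈ E.grKer :=
  ⟨AddSubmonoid.subset_closure (Or.inr ⟨a, b, c, h, Or.inr rfl⟩),
    AddSubmonoid.subset_closure (Or.inr ⟨a, b, c, h, Or.inl (neg_sub _ _)⟩)⟩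

theorem mk_mem_map_grCone (E : EA.{u}) {x : FreeAbelianGroup E} :
    (x : E.GrCarrier) ∈ E.grCone.map (QuotientAddGroup.mk' E.grKer) ↔ x ∈ E.grCone := by
  constructor
  · rintro ⟨y, hy, hxy⟩
    have h1 : -y + x ∈ E.grKer := QuotientAddGroup.eq.1 hxy
    have := add_mem (s := E.grCone) hy h1.1
    rwa [add_neg_cancel_left] at this
  · exact fun h => ⟨x, h, rfl⟩

/-- The universal group of `E`: the group `GrCarrier E`, whose cone is generated by the classes
`[a]`, `a ∈ E`, with the order unit `[1]`. -/
def gr (E : EA.{u}) : POGu.{u} :=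
  letI : PartialOrder E.GrCarrier :=
    { le := fun x y => y - x ∈ E.grCone.map (QuotientAddGroup.mk' E.grKer)
      le_refl := fun x => by rw [sub_self]; exact zero_mem _
      le_trans := fun x y z h1 h2 => by
        have := add_mem h1 h2
        rwa [sub_add_sub_cancel'] at this
      le_antisymm := by
        intro x y
        induction x using QuotientAddGroup.induction_on with | H x
        induction y using QuotientAddGroup.induction_on with | H y
        intro h1 h2
        have h1 : y - x ∈ E.grCone := E.mk_mem_map_grCone.1 h1
        have h2 : x - y ∈ E.grCone := E.mk_mem_map_grCone.1 h2
        refine QuotientAddGroup.eq.2 ⟨?_, ?_⟩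
        · rwa [neg_add_eq_sub]
        · rwa [neg_add_eq_sub, neg_sub] }
  letI : IsOrderedAddMonoid E.GrCarrier :=
    { add_le_add_left := fun x y h z => by
        change _ ∈ _
        rwa [add_sub_add_right_eq_sub] }
  { carrier := E.GrCarrier
    unit := (FreeAbelianGroup.of E.one : FreeAbelianGroup E)
    unit_nonneg := by
      change (_ : E.GrCarrier) - 0 ∈ _
      rw [sub_zero]
      exact E.mk_mem_map_grCone.2 (E.of_mem_grCone _)
    exists_le_nsmul_unit := by
      intro x
      induction x using QuotientAddGroup.induction_on with | H x
      have key : ∃ n : ℕ, n • FreeAbelianGroup.of E.one - x ∈ E.grCone := by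
        induction x using FreeAbelianGroup.induction_on with
        | zero => exact ⟨0, by simp [zero_mem]⟩
        | of a =>
          refine ⟨1, ?_⟩
          have h := add_mem (s := E.grCone) (E.rel_mem_grKer (E.oplus_compl a)).2
            (E.of_mem_grCone (E.compl a))
          convert h using 1
          rw [one_smul]
          abel
        | neg a _ => exact ⟨0, by simpa using E.of_mem_grCone a⟩
        | add x y hx hy =>
          obtain ⟨n, hn⟩ := hx
          obtain ⟨m, hm⟩ := hy
          refine ⟨n + m, ?_⟩
          have := add_mem hn hm
          rwa [sub_add_sub_comm, ← add_smul] at this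
      obtain ⟨n, hn⟩ := key
      exact ⟨n, E.mk_mem_map_grCone.2 hn⟩ }

/-- The element `[a]` of the universal group. -/
def grOf (E : EA.{u}) (a : E) : E.gr :=
  ((FreeAbelianGroup.of a : FreeAbelianGroup E) : E.GrCarrier)

theorem gr_nonneg (E : EA.{u}) (x : FreeAbelianGroup E) :
    (0 : E.gr) ≤ ((x : E.GrCarrier) : E.gr) ↔ x ∈ E.grCone := by
  exact (Iff.of_eq (congrArg (· ∈ E.grCone.map (QuotientAddGroup.mk' E.grKer))
    (sub_zero (x : E.GrCarrier)))).trans E.mk_mem_map_grCone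

theorem grOf_nonneg (E : EA.{u}) (a : E) : 0 ≤ E.grOf a :=
  (E.gr_nonneg _).2 (E.of_mem_grCone a)

theorem grOf_add (E : EA.{u}) {a b c : E} (h : E.oplus a b = some c) :
    E.grOf a + E.grOf b = E.grOf c := by
  refine (QuotientAddGroup.eq.2 ?_ : ((.of a + .of b : FreeAbelianGroup E) : E.GrCarrier) = _)
  have := E.grKer.neg_mem (E.rel_mem_grKer h)
  rwa [neg_sub, ← neg_add_eq_sub] at this

theorem grOf_le_unit (E : EA.{u}) (a : E) : E.grOf a ≤ E.gr.unit :=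
  (le_add_of_nonneg_right (E.grOf_nonneg _)).trans (E.grOf_add (E.oplus_compl a)).le

/-- The unit `η_E : E → Γ(Gr(E), 1)`, `a ↦ [a]`. -/
noncomputable def eta (E : EA.{u}) : E ⟶ Gam.obj E.gr :=
  ({ toFun := fun a =>
      (⟨E.grOf a, E.grOf_nonneg a, E.grOf_le_unit a⟩ : {x : E.gr // 0 ≤ x ∧ x ≤ E.gr.unit})
     map_oplus := fun _ _ _ h => (POGu.interval_oplus _ _ _).2 (E.grOf_add h)
     map_one := rfl } : Hom E E.gr.interval)

/-- The homomorphism on the universal group induced by an additive map into a po-group. -/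
def grLift {E : EA.{u}} {B : POGu.{u}} (f : E → B) (hf : ∀ a, 0 ≤ f a)
    (hadd : ∀ a b c, E.oplus a b = some c → f a + f b = f c) (h1 : f E.one = B.unit) :
    E.gr ⟶ B :=
  have pos : ∀ x ∈ E.grCone, 0 ≤ FreeAbelianGroup.lift f x := by
    intro x hx
    induction hx using AddSubmonoid.closure_induction with
    | mem x hx =>
      rcases hx with ⟨a, rfl⟩ | ⟨a, b, c, h, rfl | rfl⟩
      · simpa using hf a
      · simp [hadd a b c h]
      · simp [hadd a b c h]
    | zero => simp
    | add x y _ _ hx hy => rw [map_add]; exact add_nonneg hx hy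
  ({ toFun := QuotientAddGroup.lift E.grKer (FreeAbelianGroup.lift f) (fun x hx =>
      le_antisymm (by simpa using pos _ hx.2) (pos x hx.1))
     map_nonneg := by
      intro x hx
      induction x using QuotientAddGroup.induction_on with | H x
      exact pos x ((E.gr_nonneg x).1 hx)
     map_unit := (FreeAbelianGroup.lift_apply_of f E.one).trans h1 } : POGu.Hom E.gr B)

theorem grLift_grOf {E : EA.{u}} {B : POGu.{u}} (f : E → B) (hf : ∀ a, 0 ≤ f a)
    (hadd : ∀ a b c, E.oplus a b = some c → f a + f b = f c) (h1 : f E.one = B.unit) (a : E) :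
    (grLift f hf hadd h1).toFun (E.grOf a) = f a :=
  FreeAbelianGroup.lift_apply_of f a

theorem gr_addHom_ext {E : EA.{u}} {B : Type u} [AddCommGroup B] {f g : E.gr →+ B}
    (h : ∀ a, f (E.grOf a) = g (E.grOf a)) : f = g :=
  QuotientAddGroup.addMonoidHom_ext _ (FreeAbelianGroup.lift_ext _ _ h)

theorem gr_hom_ext {E : EA.{u}} {B : POGu.{u}} {f g : E.gr ⟶ B}
    (h : ∀ a, f.toFun (E.grOf a) = g.toFun (E.grOf a)) : f = g :=
  POGu.Hom.ext (gr_addHom_ext h)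

/-- `Gr(f)`, given by `[a] ↦ [f a]`. -/
def grMap {E F : EA.{u}} (f : E ⟶ F) : E.gr ⟶ F.gr :=
  grLift (fun a => F.grOf (f.toFun a)) (fun _ => F.grOf_nonneg _)
    (fun _ _ _ h => F.grOf_add (f.map_oplus _ _ _ h)) (congrArg F.grOf f.map_one)

theorem grMap_grOf {E F : EA.{u}} (f : E ⟶ F) (a : E) :
    (grMap f).toFun (E.grOf a) = F.grOf (f.toFun a) := grLift_grOf _ _ _ _ a

end EA

/-- The universal group functor `Gr`. -/
def Gr : EA.{u} ⥤ POGu.{u} where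
  obj E := E.gr
  map f := EA.grMap f
  map_id _ := EA.gr_hom_ext fun a => EA.grMap_grOf _ a
  map_comp f g := EA.gr_hom_ext fun a => (EA.grMap_grOf (f ≫ g) a).trans
    ((congrArg (EA.grMap g).toFun (EA.grMap_grOf f a)).trans (EA.grMap_grOf g _)).symm

/-- The functor `Gr` between the under categories, sending `g : E → F` to `Gr(g)`. -/
def underGr (E : EA.{u}) : Under E ⥤ Under (Gr.obj E) := Under.post Gr

/-- The functor `Γ` between the under categories, sending `h : Gr(E) → (B, v)` to the composite
`h̄ : E → Γ(Gr(E), 1) → Γ(B, v)` of `η_E` and `Γ(h)`. -/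
noncomputable def underGam (E : EA.{u}) : Under (Gr.obj E) ⥤ Under E :=
  Under.post Gam ⋙ Under.map (EA.eta E)

/-! ## The adjunction `Gr ⊣ Γ` -/

/-! The theorem compares two ways around a square of adjunctions, and the whole content sits on the
side of the right adjoints. A positive group homomorphism g : Gr(E) → B with g ≤ h is determined by
the values g[x], because the classes [x] generate Gr(E) as a group. They also generate its cone, so
that positivity of g and of h - g can be tested on these classes (`EA.isPos_iff_grOf`). Hence the
conditions 0 ≤ g ≤ h say exactly that x ↦ g[x] takes values in Γ(B, v) and lies below h̄.
Conversely, every orthosum-preserving f : E → Γ(B, v) below h̄ extends additively to Gr(E) by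
`EA.grAddLift`, and the extension lies between 0 and h. Such an f need not send 1 to v, so this
extension is not an instance of the universal property of Gr(E) among unital po-groups.

Restriction and extension are therefore mutually inverse. Since the sum of two homomorphisms is also
determined on generators, restriction both preserves and reflects orthosums
(`restrictGr_oplus_iff`). This gives β, and its naturality is immediate because both functors act by
composition.

Once the four adjunctions are constructed with explicit units and counits, the two composites Γ ∘
[Gr(E), -] and [E, Γ(-)] have the left adjoints F ↦ Gr(E) ⊗ Gr(F) and F ↦ Gr(E ⊗ F). Left adjoints
of isomorphic functors are isomorphic, so α is defined as the conjugate of β. No inverse of [x ⊗ y]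
↦ [x] ⊗ [y] has to be built by hand, and conjugacy holds by construction. -/

namespace POGu

/-- The counit `Gr(Γ(B, v)) → (B, v)`, given by `[b] ↦ b`. -/
noncomputable def grCounit (B : POGu.{u}) : Gr.obj (Gam.obj B) ⟶ B :=
  EA.grLift (E := B.interval) (fun b : {x : B // 0 ≤ x ∧ x ≤ B.unit} => b.1) (fun b => b.2.1)
    (fun a b c h => (interval_oplus a b c).1 h) rfl

theorem grCounit_grOf (B : POGu.{u}) (b : {x : B // 0 ≤ x ∧ x ≤ B.unit}) :
    (grCounit B).toFun (EA.grOf B.interval b) = b.1 :=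
  EA.grLift_grOf _ _ _ _ _

theorem grCounit_naturality {B C : POGu.{u}} (f : B ⟶ C) :
    Gr.map (Gam.map f) ≫ grCounit C = grCounit B ≫ f :=
  EA.gr_hom_ext fun b =>
    (congrArg (grCounit C).toFun (EA.grMap_grOf (Gam.map f) b)).trans
      ((grCounit_grOf C _).trans (congrArg f.toFun (grCounit_grOf B b)).symm)

/-- One triangle identity: b ↦ [b] ↦ b. -/
theorem eta_grCounit (B : POGu.{u}) :
    EA.eta (Gam.obj B) ≫ Gam.map (grCounit B) = 𝟙 (Gam.obj B) :=
  EA.hom_ext fun b => Subtype.ext (grCounit_grOf B b)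

end POGu

namespace EA

/-- Besides naturality of the unit, this equation is the commuting triangle that makes η a morphism
of the category under E. -/
theorem eta_naturality {E F : EA.{u}} (f : E ⟶ F) :
    f ≫ eta F = eta E ≫ Gam.map (Gr.map f) :=
  hom_ext fun a => Subtype.ext (grMap_grOf f a).symm

/-- The other triangle identity; on generators it reads [a] ↦ [[a]] ↦ [a]. -/
theorem gr_eta_grCounit (E : EA.{u}) :
    Gr.map (eta E) ≫ POGu.grCounit (Gr.obj E) = 𝟙 (Gr.obj E) :=
  gr_hom_ext fun a => (congrArg (POGu.grCounit (Gr.obj E)).toFun (grMap_grOf (eta E) a)).trans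
    (POGu.grCounit_grOf E.gr _)

end EA

/-- The adjunction `Gr ⊣ Γ` between effect algebras and unital Abelian po-groups. -/
noncomputable def grAdjGam : Gr.{u} ⊣ Gam.{u} where
  unit := { app := EA.eta, naturality := fun _ _ f => EA.eta_naturality f }
  counit := { app := POGu.grCounit, naturality := fun _ _ f => POGu.grCounit_naturality f }
  left_triangle_components := EA.gr_eta_grCounit
  right_triangle_components := POGu.eta_grCounit

/-- The adjunction `Gr ⊣ Γ` between the under categories of `E` and `Gr(E)`. -/
noncomputable def underGrAdjUnderGam (E : EA.{u}) : underGr E ⊣ underGam E where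
  unit :=
    { app := fun g => Under.homMk (EA.eta g.right) (EA.eta_naturality g.hom)
      naturality := fun _ _ k => Under.UnderMorphism.ext (EA.eta_naturality k.right) }
  counit :=
    -- The counit is that of Gr ⊣ Γ. It lies under Gr(E) because [a] ↦ [h[a]] ↦ h[a], and generators
    -- suffice.
    { app := fun h => Under.homMk (POGu.grCounit h.right) (by
        refine EA.gr_hom_ext fun a => ?_
        refine (congrArg (POGu.grCounit h.right).toFun
          (EA.grMap_grOf (EA.eta E ≫ Gam.map h.hom) a)).trans ?_
        exact POGu.grCounit_grOf h.right _)
      naturality := fun _ _ k => Under.UnderMorphism.ext (POGu.grCounit_naturality k.right) }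
  left_triangle_components g := Under.UnderMorphism.ext (EA.gr_eta_grCounit g.right)
  right_triangle_components h := Under.UnderMorphism.ext (POGu.eta_grCounit h.right)

/-! ## The adjunction `E ⊗ - ⊣ [E, -]_-` for effect algebras -/

namespace EA

/-- The map `E → E ⊗ F`, `x ↦ x ⊗ y`, as an element of the interval below `x ↦ x ⊗ 1`. -/
noncomputable def tmulRight (E : EA.{u}) {F : EA.{u}} (y : F) : HomLE (tensorInl E F).toGHom where
  toFun x := (tmul E F).toFun x y
  map_oplus a b c h := (tmul E F).map_oplus_left a b c y h
  -- The complement of x ⊗ y below x ⊗ 1 is x ⊗ y'.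
  le x := ⟨_, (tmul E F).map_oplus_right x _ _ _ (F.oplus_compl y)⟩

/-- The homomorphism `F → [E, E ⊗ F]`, `y ↦ (x ↦ x ⊗ y)`. -/
noncomputable def tensorCoev (E F : EA.{u}) : F ⟶ homInterval (tensorInl E F).toGHom :=
  ({ toFun := fun y => tmulRight E y
     map_oplus := fun a b c h => (homInterval_oplus _ _ _).2 fun x =>
      (tmul E F).map_oplus_right x a b c h
     map_one := rfl } : Hom F (homInterval (tensorInl E F).toGHom))

/-- Evaluation as a bihomomorphism `E × [E, G]_h → G`. -/
def evalBihom {E G : EA.{u}} (h : E ⟶ G) : Bihom E (homInterval h.toGHom) G where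
  toFun x f := (f : HomLE h.toGHom).toFun x
  map_oplus_left a a' c f hc := (f : HomLE h.toGHom).map_oplus a a' c hc
  map_oplus_right a f f' k hk := (homInterval_oplus f f' k).1 hk a
  map_one_one := h.map_one

/-- The evaluation homomorphism `E ⊗ [E, G]_h → G`, `x ⊗ f ↦ f x`. -/
noncomputable def tensorEv {E G : EA.{u}} (h : E ⟶ G) : tensor E (homInterval h.toGHom) ⟶ G :=
  tensorLift (evalBihom h)

theorem tensorEv_tmul {E G : EA.{u}} (h : E ⟶ G) (x : E) (f : HomLE h.toGHom) :
    (tensorEv h).toFun ((tmul E (homInterval h.toGHom)).toFun x f) = f.toFun x :=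
  tensorLift_tmul (evalBihom h) x f

/-- The adjunction `E ⊗ - ⊣ [E, -]_-` between `EA` and `E ↓ EA`. -/
noncomputable def tensorAdjHom (E : EA.{u}) : tensorFunctor E ⊣ homFunctor E where
  unit :=
    { app := tensorCoev E
      naturality := fun _ _ g => hom_ext fun y => HomLE.ext (funext fun x =>
        (tensorMap_tmul E g x y).symm) }
  counit :=
    -- The greatest element of [E, G]_h is h itself, so evaluation sends x ⊗ 1 to h x; this is the
    -- triangle under E.
    { app := fun h => Under.homMk (tensorEv h.hom) (hom_ext fun x => tensorEv_tmul h.hom x _)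
      naturality := fun h h' k => Under.UnderMorphism.ext (tensor_hom_ext fun x f =>
        (congrArg (tensorEv h'.hom).toFun (tensorMap_tmul E ((homFunctor E).map k) x f)).trans
          ((tensorEv_tmul h'.hom x _).trans
            (congrArg k.right.toFun (tensorEv_tmul h.hom x f)).symm)) }
  left_triangle_components F := Under.UnderMorphism.ext (tensor_hom_ext fun x y =>
    (congrArg (tensorEv (tensorInl E F)).toFun (tensorMap_tmul E (tensorCoev E F) x y)).trans
      (tensorEv_tmul (tensorInl E F) x (tmulRight E y)))
  right_triangle_components h := hom_ext fun f => HomLE.ext (funext fun x =>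
    tensorEv_tmul h.hom x f)

end EA

/-! ## The adjunction `A ⊗ - ⊣ [A, -]_-` for unital Abelian po-groups -/

namespace POGu

/-- Membership in [A, A ⊗ B] asks for bounds on both sides; the lower one comes from bounding -b by
the order unit. -/
theorem neg_le_nsmul_unit (B : POGu.{u}) (b : B) : ∃ n : ℕ, 0 ≤ n • B.unit + b := by
  obtain ⟨n, hn⟩ := B.exists_le_nsmul_unit (-b)
  exact ⟨n, neg_le_iff_add_nonneg.1 hn⟩

/-- The map `A → A ⊗ B`, `a ↦ a ⊗ b`, as an element of the group `[A, A ⊗ B]`. -/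
noncomputable def tmulRight (A : POGu.{u}) {B : POGu.{u}} (b : B) :
    boundedSubgroup (tensorInl A B) :=
  ⟨(tmul A B).toFun.flip b, by
    obtain ⟨n, hn⟩ := B.exists_le_nsmul_unit b
    obtain ⟨m, hm⟩ := B.neg_le_nsmul_unit b
    refine ⟨⟨n, fun a ha => ?_⟩, ⟨m, fun a ha => ?_⟩⟩
    -- For a ≥ 0 the tensor a ⊗ (n v - b) is positive, and it equals n (a ⊗ v) - a ⊗ b. The lower
    -- bound below uses a ⊗ (m v + b) in the same way.
    · refine ((tmul A B).map_nonneg a _ ha (sub_nonneg.2 hn)).trans_eq ?_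
      rw [map_sub, map_nsmul]
      rfl
    · refine ((tmul A B).map_nonneg a _ ha hm).trans_eq ?_
      rw [map_add, map_nsmul]
      rfl⟩

/-- The homomorphism `B → [A, A ⊗ B]`, `b ↦ (a ↦ a ⊗ b)`. -/
noncomputable def tensorCoev (A B : POGu.{u}) : B ⟶ homBounded (tensorInl A B) :=
  ({ toFun := (AddMonoidHom.mk' (fun b => tmulRight A b)
      fun b b' => Subtype.ext (map_add (tmul A B).toFun.flip b b') :
        B →+ boundedSubgroup (tensorInl A B))
     map_nonneg := fun b hb => (homBounded_nonneg (tmulRight A b)).2 fun a ha =>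
      (tmul A B).map_nonneg a b ha hb
     map_unit := rfl } : Hom B (homBounded (tensorInl A B)))

/-- Evaluation as a bihomomorphism `A × [A, B]_h → B`. -/
def evalBihom {A B : POGu.{u}} (h : A ⟶ B) : Bihom A (homBounded h) B where
  toFun := ((boundedSubgroup h).subtype : boundedSubgroup h →+ (A →+ B)).flip
  map_nonneg a f ha hf := (homBounded_nonneg f).1 hf a ha
  map_unit := h.map_unit

/-- The evaluation homomorphism `A ⊗ [A, B]_h → B`, `a ⊗ f ↦ f a`. -/
noncomputable def tensorEv {A B : POGu.{u}} (h : A ⟶ B) : tensor A (homBounded h) ⟶ B :=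
  tensorLift (evalBihom h)

/-- The adjunction `A ⊗ - ⊣ [A, -]_-` between `POGu` and `A ↓ POGu`. -/
noncomputable def tensorAdjHom (A : POGu.{u}) : tensorFunctor A ⊣ homFunctor A where
  unit :=
    { app := tensorCoev A
      naturality := fun _ _ _ => hom_ext fun _ => Subtype.ext (AddMonoidHom.ext fun _ => rfl) }
  counit :=
    { app := fun h => Under.homMk (tensorEv h.hom) (hom_ext fun _ => rfl)
      naturality := fun _ _ _ => Under.UnderMorphism.ext (tensor_hom_ext fun _ _ => rfl) }
  left_triangle_components _ := Under.UnderMorphism.ext (tensor_hom_ext fun _ _ => rfl)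
  right_triangle_components _ := hom_ext fun _ => Subtype.ext (AddMonoidHom.ext fun _ => rfl)

end POGu

/-! ## The isomorphism `Γ([Gr(E), B]_h, h) ≅ [E, Γ(B, v)]_h̄` -/

namespace EA

/-- A map into a po-group that is positive and preserves existing orthosums induces a group
homomorphism on the universal group. -/
def grAddLift {E : EA.{u}} {B : POGu.{u}} (f : E → B) (hf : ∀ a, 0 ≤ f a)
    (hadd : ∀ a b c, E.oplus a b = some c → f a + f b = f c) : E.gr →+ B :=
  QuotientAddGroup.lift E.grKer (FreeAbelianGroup.lift f) fun x hx => by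
    have pos : ∀ x ∈ E.grCone, 0 ≤ FreeAbelianGroup.lift f x := by
      intro x hx
      induction hx using AddSubmonoid.closure_induction with
      | mem x hx =>
        rcases hx with ⟨a, rfl⟩ | ⟨a, b, c, h, rfl | rfl⟩
        · simpa using hf a
        · simp [hadd a b c h]
        · simp [hadd a b c h]
      | zero => simp
      | add x y _ _ hx hy => rw [map_add]; exact add_nonneg hx hy
    -- An element of the kernel lies in the cone together with its negative, so its image is both
    -- nonnegative and nonpositive.
    exact le_antisymm (by simpa using pos _ hx.2) (pos x hx.1)

theorem grAddLift_grOf {E : EA.{u}} {B : POGu.{u}} (f : E → B) (hf : ∀ a, 0 ≤ f a)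
    (hadd : ∀ a b c, E.oplus a b = some c → f a + f b = f c) (a : E) :
    grAddLift f hf hadd (E.grOf a) = f a :=
  FreeAbelianGroup.lift_apply_of f a

/-- The cone of the free group is generated by the letters and by the differences of the two sides
of each relation a ⊕ b = c. The latter vanish in Gr(E), so only the classes of letters impose a
condition. -/
theorem isPos_iff_grOf {E : EA.{u}} {B : POGu.{u}} (f : Gr.obj E →+ B) :
    POGu.IsPos f ↔ ∀ a, 0 ≤ f (E.grOf a) := by
  refine ⟨fun h a => h _ (E.grOf_nonneg a), fun h x hx => ?_⟩
  have key : ∀ y ∈ E.grCone, 0 ≤ f ((y : E.GrCarrier) : E.gr) := by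
    intro y hy
    induction hy using AddSubmonoid.closure_induction with
    | mem y hy =>
      rcases hy with ⟨a, rfl⟩ | ⟨a, b, c, habc, hy⟩
      · exact h a
      · have hy0 : y ∈ E.grKer := by
          rcases hy with rfl | rfl
          · rw [← neg_sub]
            exact E.grKer.neg_mem (E.rel_mem_grKer habc)
          · exact E.rel_mem_grKer habc
        have : ((y : E.GrCarrier) : E.gr) = 0 := (QuotientAddGroup.eq_zero_iff y).2 hy0
        exact ((congrArg f this).trans (map_zero f)).ge
    | zero => exact (map_zero f).ge
    | add y z _ _ ihy ihz =>
      exact (add_nonneg ihy ihz).trans_eq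
        (map_add f ((y : E.GrCarrier) : E.gr) ((z : E.GrCarrier) : E.gr)).symm
  induction x using QuotientAddGroup.induction_on with | H x
  -- Every representative of a nonnegative class already lies in the cone of the free group, since
  -- that cone absorbs the kernel.
  exact key x ((E.gr_nonneg x).1 hx)

end EA

/-- If a ≤ b in the group, then b - a lies again in [0, u] because a ≥ 0. So the algebraic order of
Γ(A, u) is the restricted one, which turns f ≤ h̄ into inequalities in B. -/
theorem POGu.interval_le {A : POGu.{u}} {a b : {x : A // 0 ≤ x ∧ x ≤ A.unit}} :
    A.interval.le a b ↔ a.1 ≤ b.1 := by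
  constructor
  · rintro ⟨c, hc⟩
    exact (le_add_of_nonneg_right c.2.1).trans_eq ((interval_oplus a c b).1 hc)
  · intro h
    exact ⟨(⟨b.1 - a.1, sub_nonneg.2 h, (sub_le_self _ a.2.1).trans b.2.2⟩ :
      {x : A // 0 ≤ x ∧ x ≤ A.unit}), (interval_oplus _ _ _).2 (add_sub_cancel _ _)⟩

/-! ### Restriction to E and extension to Gr(E) -/

section

variable {E : EA.{u}} (h : Under (Gr.obj E))

theorem apply_le_of_le_unit
    (g : {g : POGu.homBounded h.hom // 0 ≤ g ∧ g ≤ (POGu.homBounded h.hom).unit}) (x : E) :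
    (g.1 : POGu.boundedSubgroup h.hom).1 (E.grOf x) ≤ h.hom.toFun (E.grOf x) :=
  sub_nonneg.1 (g.2.2 _ (E.grOf_nonneg x))

/-- The restriction of `g : Gr(E) → B`, `0 ≤ g ≤ h`, to `E`. -/
noncomputable def restrictGr
    (g : {g : POGu.homBounded h.hom // 0 ≤ g ∧ g ≤ (POGu.homBounded h.hom).unit}) :
    EA.HomLE ((underGam E).obj h).hom.toGHom where
  toFun x := (⟨(g.1 : POGu.boundedSubgroup h.hom).1 (E.grOf x),
    (POGu.homBounded_nonneg g.1).1 g.2.1 _ (E.grOf_nonneg x),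
    -- The upper bound is g[x] ≤ h[x] ≤ v, where the second inequality is the membership of h̄ x in
    -- Γ(B, v).
    (apply_le_of_le_unit h g x).trans
      (((underGam E).obj h).hom.toFun x : {b : h.right // 0 ≤ b ∧ b ≤ h.right.unit}).2.2⟩ :
    {b : h.right // 0 ≤ b ∧ b ≤ h.right.unit})
  map_oplus _ _ _ habc := (POGu.interval_oplus _ _ _).2
    ((map_add (g.1 : POGu.boundedSubgroup h.hom).1 _ _).symm.trans
      (congrArg (g.1 : POGu.boundedSubgroup h.hom).1 (E.grOf_add habc)))
  le x := POGu.interval_le.2 (apply_le_of_le_unit h g x)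

/-- The value in `B` of an element of `[E, Γ(B, v)]_h̄`. -/
noncomputable def homLEValue (f : EA.HomLE ((underGam E).obj h).hom.toGHom) (x : E) : h.right :=
  (f.toFun x : {b : h.right // 0 ≤ b ∧ b ≤ h.right.unit}).1

/-- The group homomorphism `Gr(E) → B` that extends an element of `[E, Γ(B, v)]_h̄`. -/
noncomputable def extendGrHom (f : EA.HomLE ((underGam E).obj h).hom.toGHom) :
    Gr.obj E →+ h.right :=
  EA.grAddLift (homLEValue h f)
    (fun x => (f.toFun x : {b : h.right // 0 ≤ b ∧ b ≤ h.right.unit}).2.1)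
    (fun _ _ _ habc => (POGu.interval_oplus _ _ _).1 (f.map_oplus _ _ _ habc))

theorem extendGrHom_grOf (f : EA.HomLE ((underGam E).obj h).hom.toGHom) (x : E) :
    extendGrHom h f (E.grOf x) = homLEValue h f x :=
  EA.grAddLift_grOf _ _ _ x

theorem isPos_extendGrHom (f : EA.HomLE ((underGam E).obj h).hom.toGHom) :
    POGu.IsPos (extendGrHom h f) :=
  (EA.isPos_iff_grOf _).2 fun x => by
    rw [extendGrHom_grOf]
    exact (f.toFun x : {b : h.right // 0 ≤ b ∧ b ≤ h.right.unit}).2.1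

/-- On generators the claim is f x ≤ h̄ x, read as an inequality in B. -/
theorem isPos_sub_extendGrHom (f : EA.HomLE ((underGam E).obj h).hom.toGHom) :
    POGu.IsPos (h.hom.toFun - extendGrHom h f) :=
  (EA.isPos_iff_grOf (h.hom.toFun - extendGrHom h f)).2 fun x =>
    sub_nonneg.2 ((extendGrHom_grOf h f x).trans_le (POGu.interval_le.1 (f.le x)))

/-- The extension of an element of `[E, Γ(B, v)]_h̄` to an element of `[Gr(E), B]_h` between `0`
and `h`. -/
noncomputable def extendGr (f : EA.HomLE ((underGam E).obj h).hom.toGHom) :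
    {g : POGu.homBounded h.hom // 0 ≤ g ∧ g ≤ (POGu.homBounded h.hom).unit} :=
  let g : POGu.boundedSubgroup h.hom := ⟨extendGrHom h f,
    -- The inequalities 0 ≤ g ≤ h give the bounds g ≤ 1·h and -0·h ≤ g.
    ⟨1, by rw [one_smul]; exact isPos_sub_extendGrHom h f⟩,
    ⟨0, by rw [zero_smul, zero_add]; exact isPos_extendGrHom h f⟩⟩
  ⟨g, (POGu.homBounded_nonneg g).2 (isPos_extendGrHom h f), isPos_sub_extendGrHom h f⟩

theorem restrictGr_extendGr (f : EA.HomLE ((underGam E).obj h).hom.toGHom) :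
    restrictGr h (extendGr h f) = f :=
  EA.HomLE.ext (funext fun x => Subtype.ext (extendGrHom_grOf h f x))

/-- Orthosums on both sides are sums in B, and an equation between group homomorphisms on Gr(E) can
be checked on the classes [x]. The equivalence matters because a bijective homomorphism of effect
algebras need not reflect orthosums. -/
theorem restrictGr_oplus_iff
    (f g k : {g : POGu.homBounded h.hom // 0 ≤ g ∧ g ≤ (POGu.homBounded h.hom).unit}) :
    (EA.homInterval ((underGam E).obj h).hom.toGHom).oplus (restrictGr h f) (restrictGr h g) =
      some (restrictGr h k) ↔ (POGu.homBounded h.hom).interval.oplus f g = some k := by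
  refine (EA.homInterval_oplus _ _ _).trans (Iff.trans ?_ (POGu.interval_oplus f g k).symm)
  constructor
  · intro H
    exact Subtype.ext (EA.gr_addHom_ext fun x => (POGu.interval_oplus _ _ _).1 (H x))
  · intro H x
    exact (POGu.interval_oplus _ _ _).2
      (congrArg (fun m : POGu.boundedSubgroup h.hom => m.1 (E.grOf x)) H)

theorem extendGr_restrictGr
    (g : {g : POGu.homBounded h.hom // 0 ≤ g ∧ g ≤ (POGu.homBounded h.hom).unit}) :
    extendGr h (restrictGr h g) = g :=
  Subtype.ext (Subtype.ext (EA.gr_addHom_ext fun x => extendGrHom_grOf h (restrictGr h g) x))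

/-- This is the reflecting half of `restrictGr_oplus_iff`, carried over to the inverse map. -/
theorem extendGr_oplus (f g k : EA.HomLE ((underGam E).obj h).hom.toGHom)
    (H : (EA.homInterval ((underGam E).obj h).hom.toGHom).oplus f g = some k) :
    (POGu.homBounded h.hom).interval.oplus (extendGr h f) (extendGr h g) =
      some (extendGr h k) :=
  (restrictGr_oplus_iff h _ _ _).1 (by
    rw [restrictGr_extendGr, restrictGr_extendGr, restrictGr_extendGr]
    exact H)

/-- The isomorphism `Γ([Gr(E), B]_h, h) ≅ [E, Γ(B, v)]_h̄`, `g ↦ (x ↦ g [x])`. -/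
noncomputable def restrictGrIso :
    (POGu.homFunctor (Gr.obj E) ⋙ Gam).obj h ≅ (underGam E ⋙ EA.homFunctor E).obj h where
  hom := ({ toFun := restrictGr h
            map_oplus := fun f g k => (restrictGr_oplus_iff h f g k).2
            map_one := rfl } :
    EA.Hom (POGu.homBounded h.hom).interval (EA.homInterval ((underGam E).obj h).hom.toGHom))
  inv := ({ toFun := extendGr h
            map_oplus := extendGr_oplus h
            -- The greatest element h̄ is the restriction of h, so its extension is h again.
            map_one := extendGr_restrictGr h (POGu.homBounded h.hom).interval.one } :
    EA.Hom (EA.homInterval ((underGam E).obj h).hom.toGHom) (POGu.homBounded h.hom).interval)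
  hom_inv_id := EA.hom_ext (extendGr_restrictGr h)
  inv_hom_id := EA.hom_ext (restrictGr_extendGr h)

end

/-- The isomorphism `Γ([Gr(E), B]_h, h) ≅ [E, Γ(B, v)]_h̄` is natural in `h`. -/
noncomputable def restrictGrNatIso (E : EA.{u}) :
    POGu.homFunctor (Gr.obj E) ⋙ Gam ≅ underGam E ⋙ EA.homFunctor E :=
  -- For a morphism k out of h, both ways around the square send g to x ↦ k(g[x]).
  NatIso.ofComponents restrictGrIso fun _ =>
    EA.hom_ext fun _ => EA.HomLE.ext (funext fun _ => rfl)

/-! ### Passage to left adjoints by conjugation -/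

/-- The isomorphism `Gr(E ⊗ F) ≅ Gr(E) ⊗ Gr(F)`, natural in `F` and under `Gr(E)`, obtained as the
conjugate of `restrictGrNatIso`. -/
noncomputable def grTensorNatIso (E : EA.{u}) :
    EA.tensorFunctor E ⋙ underGr E ≅ Gr ⋙ POGu.tensorFunctor (Gr.obj E) :=
  -- Conjugation reverses direction: an isomorphism from the first right adjoint to the second
  -- corresponds to one from the second left adjoint to the first. Hence α starts at Gr(E ⊗ F).
  (conjugateIsoEquiv (grAdjGam.comp (POGu.tensorAdjHom (Gr.obj E)))
    ((EA.tensorAdjHom E).comp (underGrAdjUnderGam E))).symm (restrictGrNatIso E)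

theorem conjugate_grTensorNatIso (E : EA.{u}) :
    conjugateEquiv (grAdjGam.comp (POGu.tensorAdjHom (Gr.obj E)))
      ((EA.tensorAdjHom E).comp (underGrAdjUnderGam E)) (grTensorNatIso E).hom =
        (restrictGrNatIso E).hom :=
  (conjugateEquiv _ _).apply_symm_apply _

/-- An adjunction between given functors is determined by its unit, so the unit formulas fix all
four adjunctions, provided that the one for the under categories is read on underlying morphisms.
Likewise the formula for β determines it, and conjugacy then determines α. -/
theorem mainTheorem3 (E : EA.{u}) :
    (∀ F : EA.{u}, Nonempty (Gr.obj (EA.tensor E F) ≅ POGu.tensor (Gr.obj E) (Gr.obj F))) ∧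
    ∃ (adj : Gr.{u} ⊣ Gam.{u}) (adjUnder : underGr E ⊣ underGam E)
      (adjEA : EA.tensorFunctor E ⊣ EA.homFunctor E)
      (adjPOGu : POGu.tensorFunctor (Gr.obj E) ⊣ POGu.homFunctor (Gr.obj E))
      (α : EA.tensorFunctor E ⋙ underGr E ≅ Gr ⋙ POGu.tensorFunctor (Gr.obj E))
      (β : POGu.homFunctor (Gr.obj E) ⋙ Gam ≅ underGam E ⋙ EA.homFunctor E),
      (∀ F : EA.{u}, adj.unit.app F = EA.eta F) ∧
      (∀ g : Under E, (adjUnder.unit.app g).right = EA.eta g.right) ∧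
      (∀ (F : EA.{u}) (x : E) (y : F),
        ((adjEA.unit.app F).toFun y : EA.HomLE (EA.tensorInl E F).toGHom).toFun x =
          (EA.tmul E F).toFun x y) ∧
      (∀ (B : POGu.{u}) (a : Gr.obj E) (b : B),
        ((adjPOGu.unit.app B).toFun b : POGu.boundedSubgroup (POGu.tensorInl (Gr.obj E) B)).1 a =
          (POGu.tmul (Gr.obj E) B).toFun a b) ∧
      (∀ (h : Under (Gr.obj E))
        (g : {g : POGu.homBounded h.hom // 0 ≤ g ∧ g ≤ (POGu.homBounded h.hom).unit}) (x : E),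
        (((β.hom.app h).toFun g : EA.HomLE ((underGam E).obj h).hom.toGHom).toFun x :
            {b : h.right // 0 ≤ b ∧ b ≤ h.right.unit}).1 =
          (g.1 : POGu.boundedSubgroup h.hom).1 (E.grOf x)) ∧
      conjugateEquiv (adj.comp adjPOGu) (adjEA.comp adjUnder) α.hom = β.hom := by
  -- The isomorphism in (1) is the component of α at F with the arrow from Gr(E) forgotten.
  exact ⟨fun F => ⟨(Under.forget _).mapIso ((grTensorNatIso E).app F)⟩,
    grAdjGam, underGrAdjUnderGam E, EA.tensorAdjHom E, POGu.tensorAdjHom (Gr.obj E),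
    grTensorNatIso E, restrictGrNatIso E, fun _ => rfl, fun _ => rfl, fun _ _ _ => rfl,
    fun _ _ _ => rfl, fun _ _ _ => rfl, conjugate_grTensorNatIso E⟩
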